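/- **Model.** There are $N$ users (arms). For each user fix a $K$-state channel with stochastic transition matrix $P$, a stationary distribution $p^s=(p^s_1,\dots,p^s_K)$ of $P$ with $p^s_j>0$ for all $j$, a bounded passive reward function $R(\pi_j^\tau,0)$, $1\le j\le K$, $\tau\in\{1,2,\dots\}$, and an active reward $R^1\in\mathbb R$. The belief state $\pi_j^\tau$ means that the user was last sensed $\tau$ slots ago, in channel state $j$. In the single-arm problem with subsidy $W\in\mathbb R$, the passive action in $\pi_j^\tau$ earns $R(\pi_j^\tau,0)+W$ and leads to $\pi_j^{\tau+1}$; the active action earns $R^1$ and leads to $\pi_k^1$ with probability $p^s_k$. A policy is optimal for $W$ if, from every initial state, it maximizes $\liminf_{T\to\infty}\frac1T\mathbb E[\text{total reward over } T \text{ slots}]$ over all policies. The threshold policy $\Gamma\in(\mathbb N\cup\{0,\infty\})^K$ is passive in $\pi_j^\tau$ if $\tau\le\Gamma_j$ and active otherwise; $\mathcal L(\Gamma)$ is the set of states in which it is passive. For $\Gamma\in(\mathbb N\cup\{0\})^K$ let $\alpha^\Gamma$ be the stationary distribution of the belief state under $\Gamma$, let $E(\Gamma)$ be the stationary mean of the immediate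 reward without subsidy, and let $B(\Gamma)=\sum_{k=1}^K\sum_{r=1}^{\Gamma_k}\alpha^\Gamma(\pi_k^r)$ be the stationary passive probability. An arm is *indexable* if, for all $W<W'$ and every threshold policy $\Gamma$ optimal for $W$: $\mathcal L(\Gamma)\subseteq\mathcal L(\Gamma')$ for some threshold policy $\Gamma'$ optimal for $W'$, and $\mathcal L(\Gamma)\subseteq\mathcal L(\Gamma')$ for every threshold policy $\Gamma'$ with finite entries that is optimal for $W'$. The problem is indexable if all arms are. *Whittle's index* of a state is the smallest $W$ for which the state is indifferent, i.e. some threshold policy optimal for $W$ is passive in it and some threshold policy optimal for $W$ is active in it. **Algorithm** (for one arm). Put $\Gamma^{-1}=(0,\dots,0)$. For $\Gamma\in(\mathbb N\cup\{0,\infty\})^K$ let $\mathcal T(\Gamma)$ be the set of $\Gamma'\in(\mathbb N\cup\{0\})^K$ with $\Gamma'_j\ge\Gamma_j$ for all $j$ and $\Gamma'\ne\Gamma$. Step $i\ge0$ computes $$W_i=\inf_{\Gamma\in\mathcal T(\Gamma^{i-1})}\frac{E(\Gamma^{i-1})-E(\Gamma)}{B(\Gamma)-B(\Gamma^{i-1})},$$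 and $\Gamma^i$ is the largest minimizer, meaning the componentwise supremum of the minimizers in $(\mathbb N\cup\{0,\infty\})^K$ (and $\Gamma^i=\Gamma^{i-1}$ if there is no minimizer, in particular if $\Gamma^{i-1}$ has an infinite entry, so that $\mathcal T(\Gamma^{i-1})=\emptyset$). The step assigns $W(\pi_j^\tau):=W_i$ to all $\pi_j^\tau$ with $\Gamma^{i-1}_j<\tau\le\Gamma^i_j$. The algorithm stops after step $i$ if $\Gamma^i_j=\infty$ for all $j$. **Theorem.** Assume that for every arm and every $W\in\mathbb R$ some threshold policy is optimal, and that for every arm $B(\Gamma)$ is non-decreasing in $\Gamma$. Then the problem is indexable, and for each arm: 1. If step $i$ assigns $W_i$ to $\pi_j^\tau$, then $W_i$ is Whittle's index of $\pi_j^\tau$. 2. If $\Gamma^i_j=\infty$ for all $j$, then each state has been assigned its Whittle index in one of the steps $0,\dots,i$. 3. If all entries of $\Gamma^{i-1}$ are finite, then the infimum in step $i$ is over a non-empty set that is bounded below, and the set of minimizers is closed under componentwise maxima; if moreover it is non-empty and all entries of $\Gamma^i$ are finite, then $\Gamma^i$ is its greatest element. 4. If $R(\pi_j^\tau,0)$ is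 non-increasing in $\tau$ for all $j$, then optimal threshold policies $\Gamma(W)$, $W\in\mathbb R$, can be chosen so that $\mathcal L(\Gamma(W))\subseteq\mathcal L(\Gamma(W'))$ for all $W<W'$, and the infimum in step $i$ is attained whenever all entries of $\Gamma^{i-1}$ are finite. -/

import Mathlib

noncomputable section

/-- Belief states of one user. The pair `(j, τ)` stands for the belief `e_j P ^ τ`: the user was
last sensed `τ ≥ 1` slots ago, and the channel was then in state `j`. -/
abbrev BeliefState (K : ℕ) : Type := Fin K × ℕ+

/-- The data of one user (arm): the transition matrix `P` of its `K`-state channel, the steady-state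
probabilities `ps` of the channel (all positive), the average immediate reward `R0 j τ` of the
passive action in belief state `(j, τ)` (any bounded function), and the average immediate
reward `R1` of the active action. -/
structure Arm (K : ℕ) where
  P : Matrix (Fin K) (Fin K) ℝ
  P_nonneg : ∀ i j, 0 ≤ P i j
  P_row_sum : ∀ i, ∑ j, P i j = 1
  ps : Fin K → ℝ
  ps_pos : ∀ j, 0 < ps j
  ps_sum : ∑ j, ps j = 1
  ps_stationary : Matrix.vecMul ps P = ps
  R0 : Fin K → ℕ+ → ℝ
  R0_bounded : ∃ C : ℝ, ∀ j τ, |R0 j τ| ≤ C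
  R1 : ℝ

/-- A (history dependent, randomized) policy: `act h s` is the probability of choosing the active
action in the current state `s`, when `h` is the list of the earlier states, the latest first.
The earlier states determine the earlier actions: a slot was active iff the next state
has `τ = 1`. -/
structure ArmPolicy (K : ℕ) where
  act : List (BeliefState K) → BeliefState K → ℝ
  act_nonneg : ∀ h s, 0 ≤ act h s
  act_le_one : ∀ h s, act h s ≤ 1

/-- State `(j, τ)` is passive under the threshold vector `Γ` (with values in `ℕ ∪ {∞}`)
iff `τ ≤ Γ j`. -/
def IsPassive {K : ℕ} (Γ : Fin K → ℕ∞) (s : BeliefState K) : Prop :=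
  ((s.2 : ℕ) : ℕ∞) ≤ Γ s.1

/-- The set of belief states in which the threshold policy `Γ` prescribes the passive action. -/
def passiveSet {K : ℕ} (Γ : Fin K → ℕ∞) : Set (BeliefState K) := {s | IsPassive Γ s}

open Classical in
/-- The threshold policy `Γ`: passive in `(j, τ)` if `τ ≤ Γ j`, active otherwise. -/
def thresholdPolicy {K : ℕ} (Γ : Fin K → ℕ∞) : ArmPolicy K where
  act _ s := if IsPassive Γ s then 0 else 1
  act_nonneg _ s := by split_ifs <;> norm_num
  act_le_one _ s := by split_ifs <;> norm_num

/-- A threshold vector with finite entries, as one with entries in `ℕ ∪ {∞}`. -/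
def toExt {K : ℕ} (Γ : Fin K → ℕ) : Fin K → ℕ∞ := fun j => (Γ j : ℕ∞)

namespace Arm

variable {K : ℕ} (A : Arm K)

/-! ### Average reward of a policy, optimal threshold policies -/

/-- Expected total reward over `T` slots, with subsidy `W` for passivity, from the current state `s`
with past `h`. The passive action leads from `(j, τ)` to `(j, τ + 1)`; the active action leads to
`(k, 1)` with probability `ps k`. -/
def totalReward (W : ℝ) (φ : ArmPolicy K) : ℕ → List (BeliefState K) → BeliefState K → ℝ
  | 0, _, _ => 0
  | T + 1, h, s =>
      (1 - φ.act h s) * (A.R0 s.1 s.2 + W + totalReward W φ T (s :: h) (s.1, s.2 + 1))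
        + φ.act h s * (A.R1 + ∑ k, A.ps k * totalReward W φ T (s :: h) (k, 1))

/-- Long-run expected average reward of the policy `φ` from the initial state `s`. -/
def avgReward (W : ℝ) (φ : ArmPolicy K) (s : BeliefState K) : ℝ :=
  Filter.liminf (fun T : ℕ => A.totalReward W φ T [] s / (T : ℝ)) Filter.atTop

/-- The threshold policy `Γ` is optimal, among all policies and from every initial state, for the
average reward problem with subsidy `W`. -/
def IsOptimal (W : ℝ) (Γ : Fin K → ℕ∞) : Prop :=
  ∀ (φ : ArmPolicy K) (s : BeliefState K),
    A.avgReward W φ s ≤ A.avgReward W (thresholdPolicy Γ) s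

/-- For every subsidy, an optimal solution of the single-arm problem is of threshold type. -/
def ThresholdOptimal : Prop := ∀ W : ℝ, ∃ Γ : Fin K → ℕ∞, A.IsOptimal W Γ

/-- Indexability: for `W < W'`, the set of states that are passive under an optimal threshold policy
increases from `W` to `W'`. Every optimal `Γ` for `W` is dominated by some optimal `Γ'` for `W'`,
and by every optimal `Γ'` with finite entries. (If some entry of `Γ'` is infinite, then the arm is
eventually always passive, and the average reward does not determine the finite entries.) -/
def Indexable : Prop :=
  ∀ W W' : ℝ, W < W' → ∀ Γ : Fin K → ℕ∞, A.IsOptimal W Γ →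
    (∃ Γ' : Fin K → ℕ∞, A.IsOptimal W' Γ' ∧ passiveSet Γ ⊆ passiveSet Γ') ∧
    ∀ Γ' : Fin K → ℕ, A.IsOptimal W' (toExt Γ') → passiveSet Γ ⊆ passiveSet (toExt Γ')

/-- With subsidy `W`, optimality leaves the action in state `s` open: some optimal threshold policy
is passive in `s` and some optimal threshold policy is active in `s`. -/
def Indifferent (W : ℝ) (s : BeliefState K) : Prop :=
  (∃ Γ : Fin K → ℕ∞, A.IsOptimal W Γ ∧ IsPassive Γ s) ∧
    ∃ Γ : Fin K → ℕ∞, A.IsOptimal W Γ ∧ ¬ IsPassive Γ s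

/-- `w` is Whittle's index of the state `s`: the smallest subsidy that makes `s` indifferent. -/
def IsWhittleIndex (s : BeliefState K) (w : ℝ) : Prop :=
  IsLeast {W : ℝ | A.Indifferent W s} w

/-! ### Steady state under a threshold policy with finite thresholds -/

open Classical in
/-- One-step transition probability from `s` to `s'` under the threshold policy `Γ`. -/
def trans (Γ : Fin K → ℕ) (s s' : BeliefState K) : ℝ :=
  if IsPassive (toExt Γ) s then (if s' = (s.1, s.2 + 1) then 1 else 0)
  else (if s'.2 = 1 then A.ps s'.1 else 0)

/-- `α` is a stationary probability distribution of the belief state under the policy `Γ`. -/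
def IsStationary (Γ : Fin K → ℕ) (α : BeliefState K → ℝ) : Prop :=
  (∀ s, 0 ≤ α s) ∧ HasSum α 1 ∧ ∀ s', HasSum (fun s => α s * A.trans Γ s s') (α s')

/-- The steady-state distribution `α^Γ` under the threshold policy `Γ`: the distribution that
satisfies `IsStationary`. -/
def steadyState (Γ : Fin K → ℕ) : BeliefState K → ℝ :=
  Classical.epsilon (A.IsStationary Γ)

/-- Stationary probability `∑_k ∑_{r=1}^{Γ_k} α^Γ(k, r)` of the passive action. -/
def passiveProb (Γ : Fin K → ℕ) : ℝ :=
  ∑ k, ∑ r ∈ Finset.range (Γ k), A.steadyState Γ (k, r.succPNat)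

open Classical in
/-- Stationary mean of the immediate reward (without subsidy) under the policy `Γ`. -/
def meanReward (Γ : Fin K → ℕ) : ℝ :=
  ∑' s : BeliefState K,
    A.steadyState Γ s * (if IsPassive (toExt Γ) s then A.R0 s.1 s.2 else A.R1)

/-! ### The algorithm -/

/-- `𝒯(Γ)`: the vectors of natural numbers that are larger than `Γ` (every entry at least as large,
and not equal). It is empty as soon as `Γ` has an infinite entry. -/
def largerThresholds (Γ : Fin K → ℕ∞) : Set (Fin K → ℕ) := {Γ' | Γ < toExt Γ'}

/-- The ratio (reward difference) / (passive-probability difference) of `Γ` and `Γ'`. -/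
def ratio (Γ Γ' : Fin K → ℕ) : ℝ :=
  (A.meanReward Γ - A.meanReward Γ') / (A.passiveProb Γ' - A.passiveProb Γ)

/-- The ratios over which a step that starts from `Γ` takes the infimum. (The set is nonempty only
if all entries of `Γ` are finite, and then `toNat` returns them.) -/
def stepRatios (Γ : Fin K → ℕ∞) : Set ℝ :=
  A.ratio (fun j => (Γ j).toNat) '' largerThresholds Γ

/-- The infimum that is computed in a step that starts from `Γ`. -/
def stepValue (Γ : Fin K → ℕ∞) : ℝ := sInf (A.stepRatios Γ)

/-- The minimizers in a step that starts from `Γ`. -/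
def minimizers (Γ : Fin K → ℕ∞) : Set (Fin K → ℕ) :=
  {Γ' ∈ largerThresholds Γ | A.ratio (fun j => (Γ j).toNat) Γ' = A.stepValue Γ}

/-- The largest minimizer in a step that starts from `Γ`, as a supremum in `(ℕ ∪ {∞})^K`: an entry
is `∞` if that entry is unbounded over the minimizers. (It is `Γ` itself if there is none.) -/
def nextThreshold (Γ : Fin K → ℕ∞) : Fin K → ℕ∞ :=
  Γ ⊔ ⨆ Γ' ∈ A.minimizers Γ, toExt Γ'

/-- The thresholds of the algorithm, with the index shifted by one: `algThreshold 0` is the zero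
vector `Γ^{-1}`, and `algThreshold (i + 1)` is the vector `Γ^i` that step `i` returns. -/
def algThreshold : ℕ → Fin K → ℕ∞
  | 0 => 0
  | i + 1 => A.nextThreshold (algThreshold i)

/-- The value `W_i` that is computed in step `i`, which starts from `Γ^{i-1}`. -/
def algValue (i : ℕ) : ℝ := A.stepValue (A.algThreshold i)

/-- Step `i` of the algorithm assigns its value to `(j, τ)`: `Γ^{i-1}_j < τ ≤ Γ^i_j`. -/
def AssignedAt (i : ℕ) (s : BeliefState K) : Prop :=
  A.algThreshold i s.1 < ((s.2 : ℕ) : ℕ∞) ∧ ((s.2 : ℕ) : ℕ∞) ≤ A.algThreshold (i + 1) s.1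

end Arm

/-- The restless bandit problem is indexable if all its arms are. -/
def ProblemIndexable {N K : ℕ} (arm : Fin N → Arm K) : Prop := ∀ n, (arm n).Indexable

end

/-! Active slots cut time into cycles: the channel is found in state `k` with probability `ps k`,
and `Γ k` passive slots follow before the next sensing. So the average reward of a finite vector is
the ratio `gain W Γ`, and it compares with a charge `v` per slot according to the sign of `R1 - v +
∑ k, ps k * (passiveSum k (Γ k) - (v - W) * Γ k)` (`gain_sub_mul_cycleLength`). In this form the
channel states decouple.

Let U(W) = `optGain W - W`. No policy beats `optGain W` (`avgReward_le_optGain`). An optimal finite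
vector maximizes `passiveSum k n - U * n` in each coordinate (`passiveSum_sub_le`), and a finite
vector that does equally well in each coordinate is optimal too (`gain_eq_optGain_of_forall`). A
vector with infinite entries is optimal iff passivity sustains the average U in the channel states
concerned (`isOptimal_iff_of_eq_top`).

As U does not increase with W, the maximizers move up; this is `le_of_optimal`, and indexability
follows.

For the algorithm, `ratio Γ Γ'` is the subsidy at which two affine functions of W, the gains of Γ
and Γ', cross. Hence `stepValue` is the largest subsidy for which the current finite vector is
optimal, and the minimizers are the larger finite vectors optimal for it (`mem_minimizers_iff`). A
state assigned in this step is active under the current vector and passive under a minimizer, so it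
is indifferent. For a smaller subsidy all optimal vectors lie below the current one, so none is
passive in that state. -/

/-! ### Threshold vectors and sums over belief states -/

theorem isPassive_toExt_iff {K : ℕ} (Γ : Fin K → ℕ) (k : Fin K) (n : ℕ) :
    IsPassive (toExt Γ) (k, n.succPNat) ↔ n < Γ k := by
  simp only [IsPassive, toExt, Nat.succPNat_coe, Nat.cast_le, Nat.succ_le_iff]

theorem toExt_le_toExt {K : ℕ} {Γ Γ' : Fin K → ℕ} : toExt Γ ≤ toExt Γ' ↔ Γ ≤ Γ' := by
  simp [Pi.le_def, toExt]

theorem toExt_lt_toExt {K : ℕ} {Γ Γ' : Fin K → ℕ} : toExt Γ < toExt Γ' ↔ Γ < Γ' := by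
  simp only [lt_iff_le_not_ge, toExt_le_toExt]

theorem toExt_toNat {K : ℕ} {Γ : Fin K → ℕ∞} (h : ∀ j, Γ j ≠ ⊤) :
    toExt (fun j => (Γ j).toNat) = Γ :=
  funext fun j => ENat.natCast_toNat (h j)

theorem exists_toExt_or_exists_eq_top {K : ℕ} (Γ : Fin K → ℕ∞) :
    (∃ G : Fin K → ℕ, Γ = toExt G) ∨ ∃ j, Γ j = ⊤ := by
  by_cases h : ∃ j, Γ j = ⊤
  · exact Or.inr h
  · push Not at h
    exact Or.inl ⟨_, (toExt_toNat h).symm⟩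

theorem passiveSet_subset_passiveSet {K : ℕ} {Γ Γ' : Fin K → ℕ∞} :
    passiveSet Γ ⊆ passiveSet Γ' ↔ Γ ≤ Γ' := by
  refine ⟨fun h j => ?_, fun h s hs => le_trans hs (h s.1)⟩
  refine ENat.forall_natCast_le_iff_le.1 fun n hn => ?_
  cases n with
  | zero => simp
  | succ n => exact h (a := (j, n.succPNat)) hn

/-- The index `n` stands for age `n + 1`. In steady state, row `k` carries mass only on `n ≤ Γ k`:
the `Γ k` passive states and, at `n = Γ k`, the one active state. -/
theorem hasSum_beliefState {K : ℕ} {Γ : Fin K → ℕ} {f : BeliefState K → ℝ}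
    (h : ∀ k n, Γ k < n → f (k, n.succPNat) = 0) :
    HasSum f (∑ k, ∑ n ∈ Finset.range (Γ k + 1), f (k, n.succPNat)) := by
  classical
  set e : (Σ _ : Fin K, ℕ) → BeliefState K := fun x => (x.1, x.2.succPNat) with he
  have hinj : Function.Injective e := by
    rintro ⟨a, b⟩ ⟨c, d⟩ hx
    simp only [he, Prod.mk.injEq, Nat.succPNat_inj] at hx
    obtain ⟨rfl, rfl⟩ := hx
    rfl
  have := hasSum_sum_of_ne_finset_zero (f := f) (L := SummationFilter.unconditional _)
    (s := (Finset.univ.sigma fun k => Finset.range (Γ k + 1)).image e) fun s hs => by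
      obtain ⟨k, τ⟩ := s
      obtain ⟨n, rfl⟩ : ∃ n : ℕ, n.succPNat = τ := ⟨τ.natPred, τ.succPNat_natPred⟩
      refine h k n ?_
      by_contra hn
      exact hs (Finset.mem_image.2 ⟨⟨k, n⟩, by simp; omega, rfl⟩)
  rwa [Finset.sum_image hinj.injOn, Finset.sum_sigma] at this

/-! ### Sensing cycles of a threshold policy -/

namespace Arm

variable {K : ℕ} (A : Arm K)

/-- Total passive reward, without subsidy, over the first `n` slots after the user was sensed in
channel state `j`. -/
noncomputable def passiveSum (j : Fin K) (n : ℕ) : ℝ := ∑ r ∈ Finset.range n, A.R0 j r.succPNat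

@[simp] theorem passiveSum_zero (j : Fin K) : A.passiveSum j 0 = 0 := rfl

theorem passiveSum_succ (j : Fin K) (n : ℕ) :
    A.passiveSum j (n + 1) = A.passiveSum j n + A.R0 j n.succPNat :=
  Finset.sum_range_succ _ _

/-- Expected number of slots between two active slots under the threshold policy `Γ`. -/
noncomputable def cycleLength (Γ : Fin K → ℕ) : ℝ := 1 + ∑ k, A.ps k * Γ k

theorem one_le_cycleLength (Γ : Fin K → ℕ) : 1 ≤ A.cycleLength Γ :=
  le_add_of_nonneg_right <| Finset.sum_nonneg fun k _ => mul_nonneg (A.ps_pos k).le (Nat.cast_nonneg _)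

theorem cycleLength_pos (Γ : Fin K → ℕ) : 0 < A.cycleLength Γ :=
  one_pos.trans_le (A.one_le_cycleLength Γ)

theorem cycleLength_lt {Γ Γ' : Fin K → ℕ} (h : Γ < Γ') : A.cycleLength Γ < A.cycleLength Γ' := by
  obtain ⟨hle, j, hj⟩ := Pi.lt_def.1 h
  refine add_lt_add_right (Finset.sum_lt_sum (fun k _ => ?_) ⟨j, Finset.mem_univ j, ?_⟩) _
  · exact mul_le_mul_of_nonneg_left (Nat.cast_le.2 (hle k)) (A.ps_pos k).le
  · exact mul_lt_mul_of_pos_left (Nat.cast_lt.2 hj) (A.ps_pos j)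

/-- A channel has at least one state. -/
theorem nonempty_channelState (A : Arm K) : Nonempty (Fin K) := by
  by_contra h
  have := not_nonempty_iff.1 h
  simpa using A.ps_sum

/-! ### The steady state -/

open Classical in
theorem trans_succ (Γ : Fin K → ℕ) (s : BeliefState K) (k : Fin K) (n : ℕ) :
    A.trans Γ s (k, (n + 1).succPNat) = if s = (k, n.succPNat) ∧ n < Γ k then 1 else 0 := by
  obtain ⟨j, τ⟩ := s
  obtain ⟨m, rfl⟩ : ∃ m : ℕ, m.succPNat = τ := ⟨τ.natPred, τ.succPNat_natPred⟩
  have h1 : (n + 1).succPNat ≠ 1 := fun h => by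
    simpa using congrArg PNat.val h
  have h2 : m.succPNat + 1 = (m + 1).succPNat := rfl
  simp only [trans, isPassive_toExt_iff, h1, h2, Prod.mk.injEq, Nat.succPNat_inj, if_false]
  by_cases hjk : k = j
  · subst hjk
    by_cases hmn : n = m
    · subst hmn; simp
    · simp [hmn, Ne.symm hmn]
  · simp [hjk, Ne.symm hjk]

open Classical in
theorem trans_one (Γ : Fin K → ℕ) (s : BeliefState K) (k : Fin K) :
    A.trans Γ s (k, 1) = A.ps k * if IsPassive (toExt Γ) s then 0 else 1 := by
  have h1 : (1 : ℕ+) ≠ s.2 + 1 := fun h => by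
    have := congrArg PNat.val h
    have := s.2.pos
    simp at *
  simp [trans, h1]

theorem IsStationary.succ {Γ : Fin K → ℕ} {α : BeliefState K → ℝ} (h : A.IsStationary Γ α)
    (k : Fin K) (n : ℕ) :
    α (k, (n + 1).succPNat) = if n < Γ k then α (k, n.succPNat) else 0 := by
  classical
  refine (h.2.2 (k, (n + 1).succPNat)).unique ?_
  have := hasSum_single (f := fun s => α s * A.trans Γ s (k, (n + 1).succPNat)) (k, n.succPNat)
    fun s hs => by simp [trans_succ, hs]
  simpa [trans_succ] using this

theorem IsStationary.eq {Γ : Fin K → ℕ} {α : BeliefState K → ℝ} (h : A.IsStationary Γ α)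
    (k : Fin K) (n : ℕ) :
    α (k, n.succPNat) = if n ≤ Γ k then A.ps k / A.cycleLength Γ else 0 := by
  classical
  -- `c` is the stationary probability of the active action. Balance at `(k, 1)` gives mass `ps k *
  -- c`, passivity carries it along the row unchanged, and total mass 1 forces `c = 1 / cycleLength
  -- Γ`.
  set c : ℝ := ∑' s, α s * if IsPassive (toExt Γ) s then 0 else 1 with hc
  have h1 : ∀ k, α (k, 1) = A.ps k * c := fun k => by
    rw [hc, ← tsum_mul_left, ← (h.2.2 (k, 1)).tsum_eq]
    exact tsum_congr fun s => by rw [trans_one]; ring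
  have h2 : ∀ k n, α (k, n.succPNat) = if n ≤ Γ k then A.ps k * c else 0 := fun k n => by
    induction n with
    | zero => rw [if_pos (Nat.zero_le _)]; exact h1 k
    | succ n ih =>
      rw [h.succ, ih]
      by_cases hn : n < Γ k
      · simp [hn, hn.le]
      · simp [hn]
  have h3 : A.cycleLength Γ * c = 1 := by
    rw [← (hasSum_beliefState (Γ := Γ) (f := α) fun k n hn => by simp [h2, hn.not_ge]).unique h.2.1]
    have : ∀ k, ∑ n ∈ Finset.range (Γ k + 1), α (k, n.succPNat) = (A.ps k + A.ps k * Γ k) * c :=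
      fun k => by
        rw [Finset.sum_congr rfl fun n hn => (h2 k n).trans
          (if_pos (Nat.lt_succ_iff.1 (Finset.mem_range.1 hn)))]
        simp only [Finset.sum_const, Finset.card_range, nsmul_eq_mul]
        push_cast
        ring
    simp_rw [this]
    rw [← Finset.sum_mul, Finset.sum_add_distrib, A.ps_sum, cycleLength]
  rw [h2, eq_div_of_mul_eq (A.cycleLength_pos Γ).ne' ((mul_comm c _).trans h3), mul_one_div]

/-- `steadyState` is chosen by `Classical.epsilon`, so the formula of `IsStationary.eq` applies to
it only once a stationary distribution is known to exist. -/
theorem exists_isStationary (Γ : Fin K → ℕ) : ∃ α, A.IsStationary Γ α := by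
  classical
  set L := A.cycleLength Γ with hL
  have hL0 : 0 < L := A.cycleLength_pos Γ
  set α : BeliefState K → ℝ := fun s => if s.2.natPred ≤ Γ s.1 then A.ps s.1 / L else 0 with hα
  have hα' : ∀ k n, α (k, n.succPNat) = if n ≤ Γ k then A.ps k / L else 0 := fun k n => by
    by_cases hn : n ≤ Γ k <;> simp [hα, hn]
  have hα0 : ∀ k n, Γ k < n → α (k, n.succPNat) = 0 := fun k n hn => by simp [hα', hn.not_ge]
  refine ⟨α, fun s => ?_, ?_, ?_⟩
  · simp only [hα]
    split_ifs
    · exact div_nonneg (A.ps_pos _).le hL0.le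
    · exact le_rfl
  · convert hasSum_beliefState hα0
    have : ∀ k, ∑ n ∈ Finset.range (Γ k + 1), α (k, n.succPNat) = (A.ps k + A.ps k * Γ k) / L :=
      fun k => by
        rw [Finset.sum_congr rfl fun n hn => (hα' k n).trans
          (if_pos (Nat.lt_succ_iff.1 (Finset.mem_range.1 hn)))]
        simp only [Finset.sum_const, Finset.card_range, nsmul_eq_mul]
        push_cast
        ring
    simp_rw [this]
    rw [← Finset.sum_div, Finset.sum_add_distrib, A.ps_sum, ← cycleLength, ← hL, div_self hL0.ne']
  · rintro ⟨k, τ⟩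
    obtain ⟨n, rfl⟩ : ∃ n : ℕ, n.succPNat = τ := ⟨τ.natPred, τ.succPNat_natPred⟩
    cases n with
    | zero =>
      change HasSum (fun s => α s * A.trans Γ s (k, 1)) _
      convert hasSum_beliefState (Γ := Γ) (f := fun s => α s * A.trans Γ s (k, 1))
        fun k n hn => by simp [hα0 k n hn]
      have : ∀ j, ∑ n ∈ Finset.range (Γ j + 1), α (j, n.succPNat) * A.trans Γ (j, n.succPNat) (k, 1)
          = A.ps j * (A.ps k / L) := fun j => by
        rw [Finset.sum_range_succ, Finset.sum_eq_zero fun n hn => ?_]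
        · simp [trans_one, isPassive_toExt_iff, hα']
          ring
        · simp [trans_one, isPassive_toExt_iff, Finset.mem_range.1 hn]
      simp_rw [this]
      rw [← Finset.sum_mul, A.ps_sum, hα']
      simp
    | succ n =>
      have := hasSum_single (f := fun s => α s * A.trans Γ s (k, (n + 1).succPNat)) (k, n.succPNat)
        fun s hs => by simp [trans_succ, hs]
      convert this
      rw [trans_succ, hα', hα']
      by_cases hn : n < Γ k
      · simp [hn, hn.le]
      · simp [hn]

theorem steadyState_eq (Γ : Fin K → ℕ) (k : Fin K) (n : ℕ) :
    A.steadyState Γ (k, n.succPNat) = if n ≤ Γ k then A.ps k / A.cycleLength Γ else 0 :=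
  IsStationary.eq A (Classical.epsilon_spec (A.exists_isStationary Γ)) k n

theorem passiveProb_eq (Γ : Fin K → ℕ) : A.passiveProb Γ = 1 - 1 / A.cycleLength Γ := by
  have hL := (A.cycleLength_pos Γ).ne'
  have : ∀ k, ∑ n ∈ Finset.range (Γ k), A.steadyState Γ (k, n.succPNat)
      = A.ps k * Γ k / A.cycleLength Γ := fun k => by
    rw [Finset.sum_congr rfl fun n hn => (A.steadyState_eq Γ k n).trans
      (if_pos (Finset.mem_range.1 hn).le)]
    simp only [Finset.sum_const, Finset.card_range, nsmul_eq_mul]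
    ring
  simp_rw [passiveProb, this]
  rw [← Finset.sum_div, eq_sub_iff_add_eq, ← add_div, add_comm, ← cycleLength, div_self hL]

/-- Strictness, which comes from `ps_pos`, keeps the denominators in `ratio` positive. -/
theorem passiveProb_lt {Γ Γ' : Fin K → ℕ} (h : Γ < Γ') : A.passiveProb Γ < A.passiveProb Γ' := by
  rw [passiveProb_eq, passiveProb_eq]
  exact sub_lt_sub_left (one_div_lt_one_div_of_lt (A.cycleLength_pos Γ) (A.cycleLength_lt h)) _

theorem meanReward_eq (Γ : Fin K → ℕ) :
    A.meanReward Γ = (A.R1 + ∑ k, A.ps k * A.passiveSum k (Γ k)) / A.cycleLength Γ := by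
  classical
  rw [meanReward, (hasSum_beliefState (Γ := Γ)
    fun k n hn => by simp [steadyState_eq, hn.not_ge]).tsum_eq]
  have : ∀ k, ∑ n ∈ Finset.range (Γ k + 1), A.steadyState Γ (k, n.succPNat) *
      (if IsPassive (toExt Γ) (k, n.succPNat) then A.R0 k n.succPNat else A.R1)
      = (A.ps k * A.R1 + A.ps k * A.passiveSum k (Γ k)) / A.cycleLength Γ := fun k => by
    rw [Finset.sum_range_succ, Finset.sum_congr rfl fun n hn => show _ =
      A.ps k / A.cycleLength Γ * A.R0 k n.succPNat from ?_, ← Finset.mul_sum, ← passiveSum]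
    · simp [steadyState_eq, isPassive_toExt_iff]
      ring
    · have hn := Finset.mem_range.1 hn
      simp [steadyState_eq, isPassive_toExt_iff, hn, hn.le]
  simp_rw [this]
  rw [← Finset.sum_div, Finset.sum_add_distrib, ← Finset.sum_mul, A.ps_sum, one_mul]

/-! ### Average reward per cycle -/

/-- Average reward of the threshold policy `Γ` with subsidy `W`, computed over one cycle. -/
noncomputable def gain (W : ℝ) (Γ : Fin K → ℕ) : ℝ :=
  (A.R1 + ∑ k, A.ps k * (A.passiveSum k (Γ k) + W * Γ k)) / A.cycleLength Γ

theorem gain_eq_meanReward_add (W : ℝ) (Γ : Fin K → ℕ) :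
    A.gain W Γ = A.meanReward Γ + W * A.passiveProb Γ := by
  have hL := (A.cycleLength_pos Γ).ne'
  rw [passiveProb_eq, meanReward_eq, gain, one_sub_div hL, mul_div_assoc', ← add_div]
  congr 1
  simp only [mul_add, Finset.sum_add_distrib, cycleLength, add_sub_cancel_left, Finset.mul_sum,
    add_assoc]
  congr 2
  exact Finset.sum_congr rfl fun k _ => by ring

/-- For fixed `Γ` the right side is affine in `W` with negative slope; all monotonicity in the
subsidy comes from here. -/
theorem gain_sub_subsidy (W : ℝ) (Γ : Fin K → ℕ) :
    A.gain W Γ - W = A.meanReward Γ - W / A.cycleLength Γ := by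
  rw [gain_eq_meanReward_add, passiveProb_eq]
  ring

/-- Both gains are affine in `W` with slopes `passiveProb`, and that of `Γ'` is steeper; the ratio
is where they cross. -/
theorem le_ratio_iff {W : ℝ} {Γ Γ' : Fin K → ℕ} (h : Γ < Γ') :
    W ≤ A.ratio Γ Γ' ↔ A.gain W Γ' ≤ A.gain W Γ := by
  rw [ratio, le_div_iff₀ (sub_pos.2 (A.passiveProb_lt h)), gain_eq_meanReward_add,
    gain_eq_meanReward_add]
  constructor <;> intro h <;> linarith

theorem ratio_eq_iff {W : ℝ} {Γ Γ' : Fin K → ℕ} (h : Γ < Γ') :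
    A.ratio Γ Γ' = W ↔ A.gain W Γ' = A.gain W Γ := by
  rw [ratio, div_eq_iff (sub_pos.2 (A.passiveProb_lt h)).ne', gain_eq_meanReward_add,
    gain_eq_meanReward_add]
  constructor <;> intro h <;> linarith

/-- Comparison of the gain with `v`: the expected surplus over one cycle, when `v` is charged
per slot. -/
theorem gain_sub_mul_cycleLength (W v : ℝ) (Γ : Fin K → ℕ) :
    (A.gain W Γ - v) * A.cycleLength Γ =
      A.R1 - v + ∑ k, A.ps k * (A.passiveSum k (Γ k) - (v - W) * Γ k) := by
  rw [sub_mul, gain, div_mul_cancel₀ _ (A.cycleLength_pos Γ).ne', cycleLength, mul_add, mul_one,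
    Finset.mul_sum, add_sub_add_comm, ← Finset.sum_sub_distrib]
  exact congrArg _ (Finset.sum_congr rfl fun k _ => by ring)

end Arm

namespace Arm

variable {K : ℕ} (A : Arm K)

/-! ### Bounds on the reward of a policy from approximate solutions of the optimality equation -/

/-- Verification by induction on the horizon, with `v` as relative value function. Only the leftover
value at the horizon has to be bounded, so a bound on `v` from one side suffices. -/
theorem totalReward_le {W c m : ℝ} {φ : ArmPolicy K} {v : BeliefState K → ℝ} (hm : ∀ s, m ≤ v s)
    (h : ∀ l s, (1 - φ.act l s) * (A.R0 s.1 s.2 + W + v (s.1, s.2 + 1))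
      + φ.act l s * (A.R1 + ∑ k, A.ps k * v (k, 1)) ≤ c + v s) (T : ℕ) :
    ∀ l s, A.totalReward W φ T l s ≤ c * T + (v s - m) := by
  induction T with
  | zero => intro l s; simpa [totalReward] using hm s
  | succ T ih =>
    intro l s
    have h1 := ih (s :: l) (s.1, s.2 + 1)
    have h2 : ∑ k, A.ps k * A.totalReward W φ T (s :: l) (k, 1)
        ≤ (c * T - m) + ∑ k, A.ps k * v (k, 1) := by
      calc _ ≤ ∑ k, (A.ps k * (c * T - m) + A.ps k * v (k, 1)) :=
            Finset.sum_le_sum fun k _ => by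
              have := mul_le_mul_of_nonneg_left (ih (s :: l) (k, 1)) (A.ps_pos k).le
              linarith
        _ = _ := by rw [Finset.sum_add_distrib, ← Finset.sum_mul, A.ps_sum, one_mul]
    have h3 := mul_le_mul_of_nonneg_left h1 (sub_nonneg.2 (φ.act_le_one l s))
    have h4 := mul_le_mul_of_nonneg_left h2 (φ.act_nonneg l s)
    have h5 := h l s
    rw [totalReward]
    push_cast
    linarith

theorem le_totalReward {W c m : ℝ} {φ : ArmPolicy K} {v : BeliefState K → ℝ} (hm : ∀ s, v s ≤ m)
    (h : ∀ l s, c + v s ≤ (1 - φ.act l s) * (A.R0 s.1 s.2 + W + v (s.1, s.2 + 1))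
      + φ.act l s * (A.R1 + ∑ k, A.ps k * v (k, 1))) (T : ℕ) :
    ∀ l s, c * T + (v s - m) ≤ A.totalReward W φ T l s := by
  induction T with
  | zero => intro l s; simpa [totalReward] using hm s
  | succ T ih =>
    intro l s
    have h1 := ih (s :: l) (s.1, s.2 + 1)
    have h2 : (c * T - m) + ∑ k, A.ps k * v (k, 1)
        ≤ ∑ k, A.ps k * A.totalReward W φ T (s :: l) (k, 1) := by
      calc _ = ∑ k, (A.ps k * (c * T - m) + A.ps k * v (k, 1)) := by
            rw [Finset.sum_add_distrib, ← Finset.sum_mul, A.ps_sum, one_mul]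
        _ ≤ _ := Finset.sum_le_sum fun k _ => by
              have := mul_le_mul_of_nonneg_left (ih (s :: l) (k, 1)) (A.ps_pos k).le
              linarith
    have h3 := mul_le_mul_of_nonneg_left h1 (sub_nonneg.2 (φ.act_le_one l s))
    have h4 := mul_le_mul_of_nonneg_left h2 (φ.act_nonneg l s)
    have h5 := h l s
    rw [totalReward]
    push_cast
    linarith

theorem exists_abs_totalReward_le (W : ℝ) :
    ∃ M, ∀ (φ : ArmPolicy K) (T : ℕ) l s, |A.totalReward W φ T l s| ≤ M * T := by
  obtain ⟨C, hC⟩ := A.R0_bounded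
  refine ⟨max (C + |W|) |A.R1|, fun φ T l s => abs_le.2 ⟨?_, ?_⟩⟩
  all_goals
    have h0 : ∀ s : BeliefState K, |A.R0 s.1 s.2 + W| ≤ max (C + |W|) |A.R1| := fun s =>
      le_max_of_le_left ((abs_add_le _ _).trans (add_le_add_left (hC _ _) _))
    have h1 : |A.R1| ≤ max (C + |W|) |A.R1| := le_max_right _ _
  · have := A.le_totalReward (W := W) (c := -max (C + |W|) |A.R1|) (m := 0) (φ := φ)
      (v := fun _ => 0) (fun _ => le_rfl) (fun l s => by
        have := mul_le_mul_of_nonneg_left (neg_le_of_abs_le (h0 s)) (sub_nonneg.2 (φ.act_le_one l s))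
        have := mul_le_mul_of_nonneg_left (neg_le_of_abs_le h1) (φ.act_nonneg l s)
        simp only [mul_zero, Finset.sum_const_zero, add_zero]
        linarith) T l s
    simpa using this
  · have := A.totalReward_le (W := W) (c := max (C + |W|) |A.R1|) (m := 0) (φ := φ)
      (v := fun _ => 0) (fun _ => le_rfl) (fun l s => by
        have := mul_le_mul_of_nonneg_left (le_of_abs_le (h0 s)) (sub_nonneg.2 (φ.act_le_one l s))
        have := mul_le_mul_of_nonneg_left (le_of_abs_le h1) (φ.act_nonneg l s)
        simp only [mul_zero, Finset.sum_const_zero, add_zero]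
        linarith) T l s
    simpa using this

/-- A real `liminf` is meaningful only for bounded sequences; this bound and the next one secure
that. -/
theorem isBoundedUnder_ge_totalReward_div (W : ℝ) (φ : ArmPolicy K) (s : BeliefState K) :
    Filter.atTop.IsBoundedUnder (· ≥ ·) fun T : ℕ => A.totalReward W φ T [] s / (T : ℝ) := by
  obtain ⟨M, hM⟩ := A.exists_abs_totalReward_le W
  refine Filter.isBoundedUnder_of_eventually_ge (a := -M) ?_
  filter_upwards [Filter.eventually_gt_atTop 0] with T hT
  rw [le_div_iff₀ (Nat.cast_pos.2 hT), neg_mul]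
  exact neg_le_of_abs_le (hM φ T [] s)

theorem isBoundedUnder_le_totalReward_div (W : ℝ) (φ : ArmPolicy K) (s : BeliefState K) :
    Filter.atTop.IsBoundedUnder (· ≤ ·) fun T : ℕ => A.totalReward W φ T [] s / (T : ℝ) := by
  obtain ⟨M, hM⟩ := A.exists_abs_totalReward_le W
  refine Filter.isBoundedUnder_of_eventually_le (a := M) ?_
  filter_upwards [Filter.eventually_gt_atTop 0] with T hT
  rw [div_le_iff₀ (Nat.cast_pos.2 hT)]
  exact le_of_abs_le (hM φ T [] s)

theorem _root_.eventually_lt_mul_natCast (d : ℝ) {ε : ℝ} (hε : 0 < ε) :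
    ∀ᶠ T : ℕ in Filter.atTop, d < ε * T :=
  ((tendsto_natCast_atTop_atTop (R := ℝ)).const_mul_atTop hε).eventually_gt_atTop d

theorem avgReward_le {W c d : ℝ} {φ : ArmPolicy K} {s : BeliefState K}
    (h : ∀ T : ℕ, A.totalReward W φ T [] s ≤ c * T + d) : A.avgReward W φ s ≤ c := by
  refine le_of_forall_pos_le_add fun ε hε => ?_
  refine Filter.liminf_le_of_frequently_le (Filter.Eventually.frequently ?_)
    (A.isBoundedUnder_ge_totalReward_div W φ s)
  filter_upwards [Filter.eventually_gt_atTop 0, eventually_lt_mul_natCast d hε] with T hT hd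
  rw [div_le_iff₀ (Nat.cast_pos.2 hT)]
  linarith [h T]

theorem le_avgReward {W c d : ℝ} {φ : ArmPolicy K} {s : BeliefState K}
    (h : ∀ T : ℕ, c * T + d ≤ A.totalReward W φ T [] s) : c ≤ A.avgReward W φ s := by
  refine le_of_forall_pos_sub_le fun ε hε => ?_
  refine Filter.le_liminf_of_le (A.isBoundedUnder_le_totalReward_div W φ s).isCoboundedUnder_ge ?_
  filter_upwards [Filter.eventually_gt_atTop 0, eventually_lt_mul_natCast (-d) hε] with T hT hd
  rw [le_div_iff₀ (Nat.cast_pos.2 hT)]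
  linarith [h T]

theorem eventually_mul_le_totalReward {W c ε : ℝ} {φ : ArmPolicy K} {s : BeliefState K}
    (h : c ≤ A.avgReward W φ s) (hε : 0 < ε) :
    ∀ᶠ T : ℕ in Filter.atTop, (c - ε) * T ≤ A.totalReward W φ T [] s := by
  filter_upwards [Filter.eventually_lt_of_lt_liminf ((sub_lt_self c hε).trans_le h)
    (A.isBoundedUnder_ge_totalReward_div W φ s), Filter.eventually_gt_atTop 0] with T h hT
  exact ((lt_div_iff₀ (Nat.cast_pos.2 hT)).1 h).le

/-- Bounds for a threshold policy only involve the action that it prescribes. -/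
theorem act_thresholdPolicy {Γ : Fin K → ℕ∞} {s : BeliefState K} (l : List (BeliefState K))
    (p : ℝ → Prop) {x y : ℝ} (h0 : IsPassive Γ s → p x) (h1 : ¬ IsPassive Γ s → p y) :
    p ((1 - (thresholdPolicy Γ).act l s) * x + (thresholdPolicy Γ).act l s * y) := by
  by_cases hs : IsPassive Γ s
  · simpa [thresholdPolicy, hs] using h0 hs
  · simpa [thresholdPolicy, hs] using h1 hs

/-! ### The optimal average reward -/

theorem exists_abs_passiveSum_le : ∃ C, ∀ j n, |A.passiveSum j n| ≤ C * n := by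
  obtain ⟨C, hC⟩ := A.R0_bounded
  refine ⟨C, fun j n => (Finset.abs_sum_le_sum_abs _ _).trans
    ((Finset.sum_le_sum fun r _ => hC j _).trans_eq ?_)⟩
  simp [mul_comm]

theorem bddAbove_gain (W : ℝ) : BddAbove (Set.range (A.gain W)) := by
  obtain ⟨C, hC⟩ := A.exists_abs_passiveSum_le
  refine ⟨max (C + W) A.R1, ?_⟩
  rintro _ ⟨Γ, rfl⟩
  rw [gain, div_le_iff₀ (A.cycleLength_pos Γ), cycleLength, mul_add, mul_one, Finset.mul_sum]
  refine add_le_add (le_max_right _ _) (Finset.sum_le_sum fun k _ => ?_)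
  rw [mul_left_comm]
  refine mul_le_mul_of_nonneg_left ?_ (A.ps_pos k).le
  have h1 := le_of_abs_le (hC k (Γ k))
  have h2 := mul_le_mul_of_nonneg_right (le_max_left (C + W) A.R1) (Nat.cast_nonneg (α := ℝ) (Γ k))
  linarith

/-- Supremum of the average rewards of the threshold policies with finite thresholds. -/
noncomputable def optGain (W : ℝ) : ℝ := ⨆ Γ : Fin K → ℕ, A.gain W Γ

theorem gain_le_optGain (W : ℝ) (Γ : Fin K → ℕ) : A.gain W Γ ≤ A.optGain W :=
  le_ciSup (A.bddAbove_gain W) Γ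

theorem optGain_le {W x : ℝ} (h : ∀ Γ, A.gain W Γ ≤ x) : A.optGain W ≤ x := ciSup_le h

/-- The gain satisfies `gain ≤ v` iff the surplus over a cycle is not positive. -/
theorem gain_le_iff {W v : ℝ} {Γ : Fin K → ℕ} : A.gain W Γ ≤ v ↔
    A.R1 - v + ∑ k, A.ps k * (A.passiveSum k (Γ k) - (v - W) * Γ k) ≤ 0 := by
  rw [← gain_sub_mul_cycleLength, ← sub_nonpos]
  exact ⟨fun h => mul_nonpos_of_nonpos_of_nonneg h (A.cycleLength_pos Γ).le,
    fun h => nonpos_of_mul_nonpos_left h (A.cycleLength_pos Γ)⟩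

/-- The surplus from channel state `j` is bounded when `optGain` is charged per slot. -/
theorem bddAbove_passiveSum_sub (W : ℝ) (j : Fin K) :
    BddAbove (Set.range fun n : ℕ => A.passiveSum j n - (A.optGain W - W) * n) := by
  -- Threshold `n` in state `j` and 0 elsewhere leaves a single term in the cycle surplus; this is
  -- the bound it yields.
  refine ⟨(A.optGain W - A.R1) / A.ps j, ?_⟩
  rintro _ ⟨n, rfl⟩
  have := A.gain_le_iff.1 (A.gain_le_optGain W (Pi.single j n))
  rw [Finset.sum_eq_single_of_mem j (Finset.mem_univ j) fun k _ hk => by simp [hk]] at this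
  simp only [Pi.single_eq_same] at this
  rw [le_div_iff₀ (A.ps_pos j)]
  linarith

/-- The suprema need not be attained, but the coordinates are free of each other, so one finite
vector comes within `ε` of all of them. -/
theorem sum_iSup_passiveSum_sub_le (W : ℝ) :
    ∑ k, A.ps k * ⨆ n : ℕ, (A.passiveSum k n - (A.optGain W - W) * n) ≤ A.optGain W - A.R1 := by
  refine le_of_forall_pos_le_add fun ε hε => ?_
  choose Γ hΓ using fun k => exists_lt_of_lt_ciSup
    (sub_lt_self (⨆ n : ℕ, (A.passiveSum k n - (A.optGain W - W) * n)) hε)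
  have := A.gain_le_iff.1 (A.gain_le_optGain W Γ)
  calc _ ≤ ∑ k, (A.ps k * (A.passiveSum k (Γ k) - (A.optGain W - W) * Γ k) + A.ps k * ε) :=
        Finset.sum_le_sum fun k _ => by
          rw [← mul_add]
          exact mul_le_mul_of_nonneg_left (by linarith [hΓ k]) (A.ps_pos k).le
    _ ≤ _ := by
      rw [Finset.sum_add_distrib, ← Finset.sum_mul, A.ps_sum, one_mul]
      linarith

theorem passiveSum_coe (j : Fin K) (τ : ℕ+) :
    A.passiveSum j τ = A.passiveSum j τ.natPred + A.R0 j τ := by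
  conv_lhs => rw [← τ.natPred_add_one, passiveSum_succ, PNat.succPNat_natPred]

theorem _root_.PNat.natPred_add_one_eq_coe (τ : ℕ+) : (τ + 1).natPred = τ := rfl

/-- No policy has a larger average reward than `optGain`. -/
theorem avgReward_le_optGain (W : ℝ) (φ : ArmPolicy K) (s : BeliefState K) :
    A.avgReward W φ s ≤ A.optGain W := by
  set U := A.optGain W - W with hU
  -- The best surplus from `s` up to and including the next active slot, over all numbers `n` of
  -- passive slots before it. The expected value after sensing is then at most 0, which is `hact`.
  set v : BeliefState K → ℝ := fun s => A.R1 - A.optGain W + ⨆ n : ℕ,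
    (A.passiveSum s.1 (s.2.natPred + n) - A.passiveSum s.1 s.2.natPred - U * n) with hv
  have hbdd : ∀ s : BeliefState K, BddAbove (Set.range fun n : ℕ =>
      A.passiveSum s.1 (s.2.natPred + n) - A.passiveSum s.1 s.2.natPred - U * n) := fun s => by
    obtain ⟨b, hb⟩ := A.bddAbove_passiveSum_sub W s.1
    refine ⟨b + U * s.2.natPred - A.passiveSum s.1 s.2.natPred, ?_⟩
    rintro _ ⟨n, rfl⟩
    have := hb ⟨s.2.natPred + n, rfl⟩
    simp only [← hU] at this
    push_cast at this
    simp only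
    linarith
  have h0 : ∀ s, A.R1 - A.optGain W ≤ v s := fun s => by
    have := le_ciSup (hbdd s) 0
    simp only [add_zero, sub_self, Nat.cast_zero, mul_zero] at this
    simpa only [hv] using le_add_of_nonneg_right this
  have hpas : ∀ s : BeliefState K, A.R0 s.1 s.2 + W + v (s.1, s.2 + 1) ≤ A.optGain W + v s :=
    fun s => by
      have : ⨆ n : ℕ, (A.passiveSum s.1 (s.2 + n) - A.passiveSum s.1 s.2 - U * n) ≤
          U - A.R0 s.1 s.2 + ⨆ n : ℕ,
            (A.passiveSum s.1 (s.2.natPred + n) - A.passiveSum s.1 s.2.natPred - U * n) :=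
        ciSup_le fun n => by
          have := le_ciSup (hbdd s) (n + 1)
          simp only [show s.2.natPred + (n + 1) = s.2 + n by rw [← s.2.natPred_add_one]; ring]
            at this
          push_cast at this
          rw [passiveSum_coe]
          linarith
      simp only [hv, PNat.natPred_add_one_eq_coe]
      linarith
  have hact : A.R1 + ∑ k, A.ps k * v (k, 1) ≤ A.R1 := by
    have := A.sum_iSup_passiveSum_sub_le W
    have h1 : (1 : ℕ+).natPred = 0 := rfl
    simp only [hv, h1, zero_add, passiveSum_zero, sub_zero, mul_add, Finset.sum_add_distrib,
      ← Finset.sum_mul, A.ps_sum, one_mul]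
    linarith
  refine A.avgReward_le fun T => A.totalReward_le h0 (fun l s => ?_) T [] s
  have h3 := mul_le_mul_of_nonneg_left (hpas s) (sub_nonneg.2 (φ.act_le_one l s))
  have h4 := mul_le_mul_of_nonneg_left (hact.trans (by linarith [h0 s] : _ ≤ A.optGain W + v s))
    (φ.act_nonneg l s)
  linarith

end Arm

theorem isPassive_iff_of_eq_natCast {K : ℕ} {Γ : Fin K → ℕ∞} {s : BeliefState K} {n : ℕ}
    (h : Γ s.1 = n) : IsPassive Γ s ↔ s.2.natPred < n := by
  rw [IsPassive, h, Nat.cast_le, ← s.2.natPred_add_one, Nat.succ_le_iff]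

namespace Arm

variable {K : ℕ} (A : Arm K)

/-! ### Average reward of a threshold policy -/

/-- Surplus from `t` to `n` slots after the user was sensed in state `j`, when `u` is charged per
slot. -/
noncomputable def surplus (u : ℝ) (j : Fin K) (t n : ℕ) : ℝ :=
  A.passiveSum j n - A.passiveSum j t - u * (n - t)

@[simp] theorem surplus_self (u : ℝ) (j : Fin K) (n : ℕ) : A.surplus u j n n = 0 := by
  simp [surplus]

theorem surplus_natPred (u : ℝ) (s : BeliefState K) (n : ℕ) :
    A.surplus u s.1 s.2.natPred n = A.R0 s.1 s.2 - u + A.surplus u s.1 s.2 n := by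
  have : ((s.2 : ℕ) : ℝ) = s.2.natPred + 1 := by exact_mod_cast s.2.natPred_add_one.symm
  rw [surplus, surplus, passiveSum_coe, this]
  ring

theorem exists_abs_surplus_le (u : ℝ) (Γ : Fin K → ℕ) :
    ∃ b, ∀ k t, |A.surplus u k (min t (Γ k)) (Γ k)| ≤ b := by
  refine ⟨∑ k, ∑ t ∈ Finset.range (Γ k + 1), |A.surplus u k t (Γ k)|, fun k t => ?_⟩
  refine (Finset.single_le_sum (f := fun t => |A.surplus u k t (Γ k)|) (fun _ _ => abs_nonneg _)
    (Finset.mem_range.2 (Nat.lt_succ_of_le (min_le_right t (Γ k))))).trans ?_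
  exact Finset.single_le_sum (f := fun k => ∑ t ∈ Finset.range (Γ k + 1), |A.surplus u k t (Γ k)|)
    (fun _ _ => Finset.sum_nonneg fun _ _ => abs_nonneg _) (Finset.mem_univ k)

/-- The surplus up to the next active slot solves the evaluation equation of the policy exactly, so
it serves both the upper and the lower bound. The `min` covers initial states beyond the threshold,
where the policy senses at once. -/
theorem avgReward_toExt (W : ℝ) (Γ : Fin K → ℕ) (s : BeliefState K) :
    A.avgReward W (thresholdPolicy (toExt Γ)) s = A.gain W Γ := by
  set g := A.gain W Γ with hg
  obtain ⟨b, hb⟩ := A.exists_abs_surplus_le (g - W) Γ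
  set v : BeliefState K → ℝ := fun s =>
    A.R1 - g + A.surplus (g - W) s.1 (min s.2.natPred (Γ s.1)) (Γ s.1) with hv
  have hact : ∑ k, A.ps k * v (k, 1) = 0 := by
    have h := A.gain_sub_mul_cycleLength W g Γ
    rw [sub_self, zero_mul] at h
    have h1 : (1 : ℕ+).natPred = 0 := rfl
    simp only [hv, h1, zero_min, surplus, mul_add, Finset.sum_add_distrib,
      ← Finset.sum_mul, A.ps_sum, one_mul, passiveSum_zero, sub_zero, Nat.cast_zero]
    linarith
  have hpas : ∀ s, IsPassive (toExt Γ) s →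
      A.R0 s.1 s.2 + W + v (s.1, s.2 + 1) = g + v s := fun s hs => by
    have hs := (isPassive_iff_of_eq_natCast (show toExt Γ s.1 = Γ s.1 from rfl)).1 hs
    have hs' : (s.2 : ℕ) ≤ Γ s.1 := by rw [← s.2.natPred_add_one]; exact hs
    simp only [hv, PNat.natPred_add_one_eq_coe, min_eq_left hs.le, min_eq_left hs', surplus_natPred]
    ring
  have hna : ∀ s, ¬ IsPassive (toExt Γ) s → A.R1 + ∑ k, A.ps k * v (k, 1) = g + v s :=
    fun s hs => by
      rw [isPassive_iff_of_eq_natCast (show toExt Γ s.1 = Γ s.1 from rfl), not_lt] at hs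
      rw [hact]
      simp only [hv, min_eq_right hs, surplus_self]
      ring
  refine le_antisymm (A.avgReward_le (A.totalReward_le (v := v) (m := A.R1 - g - b)
    (fun s => ?_) (fun l s => ?_) · [] s)) (A.le_avgReward (A.le_totalReward (v := v)
    (m := A.R1 - g + b) (fun s => ?_) (fun l s => ?_) · [] s))
  · have := neg_le_of_abs_le (hb s.1 s.2.natPred)
    simp only [hv]
    linarith
  · exact act_thresholdPolicy l (· ≤ g + v s) (fun h => (hpas s h).le) fun h => (hna s h).le
  · have := le_of_abs_le (hb s.1 s.2.natPred)
    simp only [hv]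
    linarith
  · exact act_thresholdPolicy l (g + v s ≤ ·) (fun h => (hpas s h).ge) fun h => (hna s h).ge

/-! ### Threshold vectors with infinite entries -/

/-- The average passive reward without subsidy, from channel state `j` on, is at least `u`. -/
def Sustains (j : Fin K) (u : ℝ) : Prop :=
  ∀ ε > 0, ∀ᶠ n : ℕ in Filter.atTop, (u - ε) * n ≤ A.passiveSum j n

variable {A} in
theorem Sustains.mono {j : Fin K} {u u' : ℝ} (h : A.Sustains j u) (hu : u' ≤ u) :
    A.Sustains j u' := fun ε hε => by
  filter_upwards [h ε hε] with n hn
  exact (mul_le_mul_of_nonneg_right (by linarith) (Nat.cast_nonneg n)).trans hn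

variable {A} in
theorem Sustains.bddBelow_surplus {j : Fin K} {u ε : ℝ} (h : A.Sustains j u) (hε : 0 < ε)
    (t : ℕ) : BddBelow (Set.range fun n : ℕ => A.surplus (u - ε) j t (t + n)) := by
  have : BddBelow (Set.range fun n : ℕ => A.passiveSum j n - (u - ε) * n) := by
    refine Filter.IsBoundedUnder.bddBelow_range
      (Filter.isBoundedUnder_of_eventually_ge (a := 0) ?_)
    filter_upwards [h ε hε] with n hn
    exact sub_nonneg.2 hn
  obtain ⟨b, hb⟩ := this
  refine ⟨b - A.passiveSum j t + (u - ε) * t, ?_⟩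
  rintro _ ⟨n, rfl⟩
  have := hb ⟨t + n, rfl⟩
  simp only [surplus] at *
  linarith

/-- Each sensing hits an infinite row with probability `q > 0`, after which the arm stays passive
forever. In infinite rows the relative value is the infimum of all future surpluses, which is finite
because `c - ε` is charged instead of `c`. -/
theorem le_avgReward_of_sustains {W c : ℝ} {Γ : Fin K → ℕ∞} (hΓ : ∃ j, Γ j = ⊤)
    (h : ∀ j, Γ j = ⊤ → A.Sustains j (c - W)) (s : BeliefState K) :
    c ≤ A.avgReward W (thresholdPolicy Γ) s := by
  classical
  refine le_of_forall_pos_sub_le fun ε hε => ?_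
  set u := c - W - ε with hu
  set G : Fin K → ℕ := fun j => (Γ j).toNat with hG
  obtain ⟨b, hb⟩ := A.exists_abs_surplus_le u G
  set w : BeliefState K → ℝ := fun s => if Γ s.1 = ⊤ then
      ⨅ n : ℕ, A.surplus u s.1 s.2.natPred (s.2.natPred + n)
    else A.R1 - (c - ε) + A.surplus u s.1 (min s.2.natPred (G s.1)) (G s.1) with hw
  set q : ℝ := ∑ k, A.ps k * if Γ k = ⊤ then 1 else 0 with hq
  have hq0 : 0 < q := by
    obtain ⟨j, hj⟩ := hΓ
    refine Finset.sum_pos' (fun k _ => mul_nonneg (A.ps_pos k).le (by split_ifs <;> simp))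
      ⟨j, Finset.mem_univ j, by simpa [hj] using A.ps_pos j⟩
  -- `H` is the expected value after sensing. Only finite rows return to a sensing, so `H = ∑ k, ps
  -- k * w (k, 1) + H * (1 - q)`, and this is its solution.
  set H : ℝ := (∑ k, A.ps k * w (k, 1)) / q with hH
  set v : BeliefState K → ℝ := fun s => w s + H * (1 - if Γ s.1 = ⊤ then 1 else 0) with hv
  have hsum : ∑ k, A.ps k * v (k, 1) = H := by
    have h1 : ∑ k, A.ps k * v (k, 1) = ∑ k, A.ps k * w (k, 1) + H * (1 - q) := by
      have h2 : 1 - q = ∑ k, A.ps k * (1 - if Γ k = ⊤ then 1 else 0) := by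
        simp only [mul_sub, mul_one, Finset.sum_sub_distrib, A.ps_sum, hq]
      rw [h2, Finset.mul_sum, ← Finset.sum_add_distrib]
      exact Finset.sum_congr rfl fun k _ => by simp only [hv]; ring
    have h2 : H * q = ∑ k, A.ps k * w (k, 1) := div_mul_cancel₀ _ hq0.ne'
    rw [h1, ← h2]
    ring
  have hbdd : ∀ s : BeliefState K, Γ s.1 = ⊤ → BddBelow (Set.range fun n : ℕ =>
      A.surplus u s.1 s.2.natPred (s.2.natPred + n)) := fun s hs =>
    (h s.1 hs).bddBelow_surplus hε _
  have hcast : ∀ {j}, Γ j ≠ ⊤ → Γ j = G j := fun hj => (ENat.natCast_toNat hj).symm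
  refine A.le_avgReward (A.le_totalReward (v := v)
    (m := max 0 (A.R1 - (c - ε) + b + H)) (fun s => ?_) (fun l s => ?_) · [] s)
  · by_cases hs : Γ s.1 = ⊤
    · have := ciInf_le (hbdd s hs) 0
      simp only [add_zero, surplus_self] at this
      simp only [hv, hw, hs, if_true, sub_self, mul_zero, add_zero]
      exact le_max_of_le_left this
    · have := le_of_abs_le (hb s.1 s.2.natPred)
      simp only [hv, hw, hs, if_false, sub_zero, mul_one]
      exact le_max_of_le_right (by linarith)
  · refine act_thresholdPolicy l (c - ε + v s ≤ ·) (fun hp => ?_) fun hp => ?_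
    · by_cases hs : Γ s.1 = ⊤
      · have : (⨅ n : ℕ, A.surplus u s.1 s.2.natPred (s.2.natPred + n)) - (A.R0 s.1 s.2 - u) ≤
            ⨅ n : ℕ, A.surplus u s.1 s.2 (s.2 + n) := le_ciInf fun n => by
          have := ciInf_le (hbdd s hs) (n + 1)
          simp only [show s.2.natPred + (n + 1) = s.2 + n by rw [← s.2.natPred_add_one]; ring,
            surplus_natPred] at this ⊢
          linarith
        simp only [hv, hw, hs, if_true, PNat.natPred_add_one_eq_coe, sub_self, mul_zero, add_zero]
        linarith
      · have hp := (isPassive_iff_of_eq_natCast (hcast hs)).1 hp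
        have hp' : (s.2 : ℕ) ≤ G s.1 := by rw [← s.2.natPred_add_one]; exact hp
        simp only [hv, hw, hs, if_false, PNat.natPred_add_one_eq_coe, min_eq_left hp.le,
          min_eq_left hp', surplus_natPred]
        linarith
    · have hs : Γ s.1 ≠ ⊤ := fun hs => hp (by simp [IsPassive, hs])
      rw [isPassive_iff_of_eq_natCast (hcast hs), not_lt] at hp
      rw [hsum]
      simp only [hv, hw, hs, if_false, min_eq_right hp, surplus_self]
      linarith

theorem totalReward_of_eq_top (W : ℝ) {Γ : Fin K → ℕ∞} {j : Fin K} (hj : Γ j = ⊤) (T : ℕ) :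
    ∀ l t, A.totalReward W (thresholdPolicy Γ) T l (j, t) =
      A.passiveSum j (t.natPred + T) - A.passiveSum j t.natPred + W * T := by
  induction T with
  | zero => intro l t; simp [totalReward]
  | succ T ih =>
    intro l t
    have ha : (thresholdPolicy Γ).act l (j, t) = 0 := by simp [thresholdPolicy, IsPassive, hj]
    rw [totalReward, ih, ha, PNat.natPred_add_one_eq_coe, passiveSum_coe,
      show t.natPred + (T + 1) = t + T by rw [← t.natPred_add_one]; ring]
    push_cast
    ring

variable {A} in
/-- If the passive reward from channel state `j` sustains `u`, then large thresholds for `j` have a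
gain that is close to `u + W`. -/
theorem Sustains.add_le {j : Fin K} {u W x : ℝ} (h : A.Sustains j u) (Γ : Fin K → ℕ)
    (hx : ∀ n, Γ j ≤ n → A.gain W (Function.update Γ j n) ≤ x) : u + W ≤ x := by
  by_contra! hlt
  set ε := (u - (x - W)) / 2 with hε
  have hε0 : 0 < ε := by linarith
  -- `c` is the part of the cycle surplus that does not depend on the threshold of `j`. By the
  -- choice of `ε`, `u - ε = x - W + ε`, so row `j` adds at least `ps j * ε * n`, which outgrows
  -- `-c`.
  set c := A.R1 - x + ∑ k ∈ Finset.univ \ {j}, A.ps k * (A.passiveSum k (Γ k) - (x - W) * Γ k)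
    with hc
  obtain ⟨n, hn1, hn2, hn3⟩ := ((h ε hε0).and ((Filter.eventually_ge_atTop (Γ j)).and
    (eventually_lt_mul_natCast (-c) (mul_pos (A.ps_pos j) hε0)))).exists
  have h1 := A.gain_le_iff.1 (hx n hn2)
  rw [← Finset.sdiff_union_of_subset (Finset.subset_univ {j}),
    Finset.sum_union Finset.sdiff_disjoint, Finset.sum_singleton,
    Finset.sum_congr rfl (g := fun k => A.ps k * (A.passiveSum k (Γ k) - (x - W) * Γ k))
    fun k hk => by rw [Function.update_of_ne (by simpa using hk)]] at h1
  simp only [Function.update_self] at h1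
  have h2 := mul_le_mul_of_nonneg_left (show ε * n ≤ A.passiveSum j n - (x - W) * n by
    rw [show u - ε = x - W + ε by linarith] at hn1; linarith) (A.ps_pos j).le
  linarith

/-! ### Optimal threshold policies -/

theorem isOptimal_iff {W : ℝ} {Γ : Fin K → ℕ∞} :
    A.IsOptimal W Γ ↔ ∀ s, A.optGain W ≤ A.avgReward W (thresholdPolicy Γ) s :=
  ⟨fun h s => A.optGain_le fun Γ' => A.avgReward_toExt W Γ' s ▸ h _ s,
    fun h φ s => (A.avgReward_le_optGain W φ s).trans (h s)⟩

theorem isOptimal_toExt_iff {W : ℝ} {Γ : Fin K → ℕ} :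
    A.IsOptimal W (toExt Γ) ↔ A.gain W Γ = A.optGain W := by
  have := A.nonempty_channelState
  simp only [isOptimal_iff, avgReward_toExt, forall_const]
  exact ⟨fun h => (A.gain_le_optGain W Γ).antisymm h, fun h => h.ge⟩

/-- Started in `(j, 1)` with `Γ j = ⊤`, the policy just collects `passiveSum j`. The finite entries
of `Γ` do not enter the criterion. -/
theorem isOptimal_iff_of_eq_top {W : ℝ} {Γ : Fin K → ℕ∞} (hΓ : ∃ j, Γ j = ⊤) :
    A.IsOptimal W Γ ↔ ∀ j, Γ j = ⊤ → A.Sustains j (A.optGain W - W) := by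
  rw [isOptimal_iff]
  refine ⟨fun h j hj ε hε => ?_, fun h s => A.le_avgReward_of_sustains hΓ h s⟩
  filter_upwards [A.eventually_mul_le_totalReward (h (j, 1)) hε] with n hn
  have h1 : (1 : ℕ+).natPred = 0 := rfl
  rw [A.totalReward_of_eq_top W hj, h1, zero_add, passiveSum_zero] at hn
  linarith

end Arm

namespace Arm

variable {K : ℕ} {A : Arm K}

/-! ### Dependence on the subsidy -/

theorem optGain_sub_antitone : Antitone fun W => A.optGain W - W := fun W W' h => by
  refine sub_le_iff_le_add.2 (A.optGain_le fun Γ => ?_)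
  have h1 := A.gain_sub_subsidy W Γ
  have h2 := A.gain_sub_subsidy W' Γ
  have h3 := div_le_div_of_nonneg_right h (A.cycleLength_pos Γ).le
  have h4 := A.gain_le_optGain W Γ
  linarith

/-- The slopes `-1 / cycleLength Γ` can come arbitrarily close to 0, so the supremum alone decreases
only weakly; a maximizer at `W'` makes it strict. -/
theorem optGain_sub_lt {W W' : ℝ} (h : W < W') {Γ : Fin K → ℕ} (hΓ : A.gain W' Γ = A.optGain W') :
    A.optGain W' - W' < A.optGain W - W := by
  have h1 := A.gain_sub_subsidy W Γ
  have h2 := A.gain_sub_subsidy W' Γ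
  have h3 := div_lt_div_of_pos_right h (A.cycleLength_pos Γ)
  have h4 := A.gain_le_optGain W Γ
  linarith

theorem Sustains.le_optGain_sub {j : Fin K} {u : ℝ} (h : A.Sustains j u) (W : ℝ) :
    u ≤ A.optGain W - W :=
  le_sub_iff_add_le.2 (h.add_le 0 fun _ _ => A.gain_le_optGain W _)

/-- A gain is at least the gain of every `Γ'` if each coordinate has a surplus at least that
of `Γ'`. -/
theorem gain_le_gain {W : ℝ} {Γ Γ' : Fin K → ℕ}
    (h : ∀ k, A.passiveSum k (Γ' k) - (A.gain W Γ - W) * Γ' k ≤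
      A.passiveSum k (Γ k) - (A.gain W Γ - W) * Γ k) : A.gain W Γ' ≤ A.gain W Γ := by
  rw [gain_le_iff]
  refine le_trans (add_le_add_right (Finset.sum_le_sum fun k _ =>
    mul_le_mul_of_nonneg_left (h k) (A.ps_pos k).le) _) (A.gain_le_iff.1 le_rfl)

/-- An optimal threshold vector maximizes the surplus in each coordinate. -/
theorem passiveSum_sub_le {W : ℝ} {Γ : Fin K → ℕ} (hΓ : A.gain W Γ = A.optGain W) (j : Fin K)
    (n : ℕ) : A.passiveSum j n - (A.optGain W - W) * n ≤
      A.passiveSum j (Γ j) - (A.optGain W - W) * Γ j := by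
  have h1 := A.gain_le_iff.1 (A.gain_le_optGain W (Function.update Γ j n))
  have h2 := A.gain_sub_mul_cycleLength W (A.optGain W) Γ
  rw [hΓ, sub_self, zero_mul] at h2
  rw [← Finset.sdiff_union_of_subset (Finset.subset_univ {j}),
    Finset.sum_union Finset.sdiff_disjoint, Finset.sum_singleton] at h1 h2
  rw [Finset.sum_congr rfl (g := fun k => A.ps k * (A.passiveSum k (Γ k) - (A.optGain W - W) * Γ k))
    fun k hk => by rw [Function.update_of_ne (by simpa using hk)]] at h1
  simp only [Function.update_self] at h1
  exact le_of_mul_le_mul_left (by linarith) (A.ps_pos j)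

/-- When `optGain W` is charged, the cycle surplus of `Γ` is 0, so that of `Γ'` is at least 0. This
allows entries of different optimal vectors to be combined. -/
theorem gain_eq_optGain_of_forall {W : ℝ} {Γ Γ' : Fin K → ℕ} (hΓ : A.gain W Γ = A.optGain W)
    (h : ∀ k, A.passiveSum k (Γ k) - (A.optGain W - W) * Γ k ≤
      A.passiveSum k (Γ' k) - (A.optGain W - W) * Γ' k) : A.gain W Γ' = A.optGain W := by
  have h1 := A.gain_sub_mul_cycleLength W (A.optGain W) Γ
  have h2 := A.gain_sub_mul_cycleLength W (A.optGain W) Γ'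
  rw [hΓ, sub_self, zero_mul] at h1
  have h3 : 0 ≤ (A.gain W Γ' - A.optGain W) * A.cycleLength Γ' := by
    rw [h1, h2]
    exact add_le_add_right (Finset.sum_le_sum fun k _ =>
      mul_le_mul_of_nonneg_left (h k) (A.ps_pos k).le) _
  exact (A.gain_le_optGain W Γ').antisymm
    (sub_nonneg.1 (nonneg_of_mul_nonneg_left h3 (A.cycleLength_pos Γ')))

theorem gain_sup_eq_optGain {W : ℝ} {Γ Γ' : Fin K → ℕ} (hΓ : A.gain W Γ = A.optGain W)
    (hΓ' : A.gain W Γ' = A.optGain W) : A.gain W (Γ ⊔ Γ') = A.optGain W :=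
  gain_eq_optGain_of_forall hΓ fun k => by
    rcases le_total (Γ k) (Γ' k) with h | h
    · simpa [h] using passiveSum_sub_le hΓ' k (Γ k)
    · simp [h]

/-- Finite optimal thresholds increase with the subsidy. -/
theorem le_of_optimal {W W' : ℝ} (h : W < W') {Γ : Fin K → ℕ∞} {Γ' : Fin K → ℕ}
    (hΓ : A.IsOptimal W Γ) (hΓ' : A.IsOptimal W' (toExt Γ')) : Γ ≤ toExt Γ' := by
  rw [isOptimal_toExt_iff] at hΓ'
  have hU := optGain_sub_lt h hΓ'
  rcases exists_toExt_or_exists_eq_top Γ with ⟨Γ, rfl⟩ | ⟨j, hj⟩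
  · rw [isOptimal_toExt_iff] at hΓ
    refine toExt_le_toExt.2 fun j => ?_
    -- The sum of the two maximality inequalities is `(U - U') * (Γ j - Γ' j) ≤ 0`, while `U' < U`.
    have h1 := passiveSum_sub_le hΓ j (Γ' j)
    have h2 := passiveSum_sub_le hΓ' j (Γ j)
    by_contra! hlt
    have h3 := mul_lt_mul_of_pos_right hU (sub_pos.2 (Nat.cast_lt (α := ℝ).2 hlt))
    linarith
  -- An infinite optimal entry at `W` would sustain U(W) forever, and hence U(W) ≤ U(W').
  · exact absurd hU (((A.isOptimal_iff_of_eq_top ⟨j, hj⟩).1 hΓ j hj).le_optGain_sub W').not_gt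

theorem IsOptimal.of_eq_top {W W' : ℝ} (h : W ≤ W') {Γ : Fin K → ℕ∞} (hΓ : A.IsOptimal W Γ)
    (htop : ∃ j, Γ j = ⊤) : A.IsOptimal W' Γ :=
  (A.isOptimal_iff_of_eq_top htop).2 fun j hj =>
    ((A.isOptimal_iff_of_eq_top htop).1 hΓ j hj).mono (optGain_sub_antitone h)

theorem indexable (hA : A.ThresholdOptimal) : A.Indexable := by
  refine fun W W' h Γ hΓ => ⟨?_, fun Γ' hΓ' =>
    passiveSet_subset_passiveSet.2 (le_of_optimal h hΓ hΓ')⟩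
  simp only [passiveSet_subset_passiveSet]
  rcases exists_toExt_or_exists_eq_top Γ with ⟨Γ, rfl⟩ | htop
  · obtain ⟨Γ', hΓ'⟩ := hA W'
    rcases exists_toExt_or_exists_eq_top Γ' with ⟨Γ', rfl⟩ | ⟨j, hj⟩
    · exact ⟨_, hΓ', le_of_optimal h hΓ hΓ'⟩
    -- `Γ'` itself may have finite entries below those of `Γ`. Raising them keeps the set of
    -- infinite entries, and so keeps optimality.
    · refine ⟨toExt Γ ⊔ Γ', ?_, le_sup_left⟩
      rw [isOptimal_iff_of_eq_top _ ⟨j, by simp [hj]⟩]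
      refine fun k hk => (A.isOptimal_iff_of_eq_top ⟨j, hj⟩).1 hΓ' k ?_
      rw [Pi.sup_apply, max_eq_top] at hk
      exact hk.resolve_left (ENat.natCast_ne_top _)
  · exact ⟨Γ, hΓ.of_eq_top h.le htop, le_rfl⟩

/-! ### A step of the algorithm -/

/-- From a subsidy on for which the finite thresholds `Γ` are optimal, it is enough to compare `Γ`
with larger finite thresholds. -/
theorem gain_eq_optGain_iff (hA : A.ThresholdOptimal) {W₀ W : ℝ} (h : W₀ ≤ W) {Γ : Fin K → ℕ}
    (hΓ : A.gain W₀ Γ = A.optGain W₀) :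
    A.gain W Γ = A.optGain W ↔ ∀ Γ', Γ < Γ' → A.gain W Γ' ≤ A.gain W Γ := by
  refine ⟨fun hW Γ' _ => hW ▸ A.gain_le_optGain W Γ', fun hW => ?_⟩
  rcases h.eq_or_lt with rfl | h
  · exact hΓ
  have hW' : ∀ Γ', Γ ≤ Γ' → A.gain W Γ' ≤ A.gain W Γ := fun Γ' hle =>
    hle.eq_or_lt.elim (fun h => h ▸ le_rfl) (hW Γ')
  refine (A.gain_le_optGain W Γ).antisymm ?_
  -- An optimal vector for `W` is either finite, and then above `Γ`, or has an infinite entry `j`;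
  -- in that case its value is approached by raising `Γ j` alone.
  obtain ⟨Γ', hΓ'⟩ := hA W
  rcases exists_toExt_or_exists_eq_top Γ' with ⟨Γ', rfl⟩ | ⟨j, hj⟩
  · rw [← A.isOptimal_toExt_iff.1 hΓ']
    exact hW' Γ' (toExt_le_toExt.1 (le_of_optimal h (A.isOptimal_toExt_iff.2 hΓ) hΓ'))
  · have := ((A.isOptimal_iff_of_eq_top ⟨j, hj⟩).1 hΓ' j hj).add_le (W := W) Γ
      fun n hn => hW' _ (le_update_self_iff.2 hn)
    linarith

theorem stepRatios_toExt (Γ : Fin K → ℕ) :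
    A.stepRatios (toExt Γ) = A.ratio Γ '' {Γ' | Γ < Γ'} := by
  simp [stepRatios, largerThresholds, toExt_lt_toExt, toExt]

theorem stepRatios_nonempty (Γ : Fin K → ℕ) : (A.stepRatios (toExt Γ)).Nonempty := by
  obtain ⟨j⟩ := A.nonempty_channelState
  rw [stepRatios_toExt]
  exact ⟨_, Γ + 1, Pi.lt_def.2 ⟨fun k => Nat.le_succ _, j, Nat.lt_succ_self _⟩, rfl⟩

theorem le_stepRatios_iff {W : ℝ} {Γ : Fin K → ℕ} :
    W ∈ lowerBounds (A.stepRatios (toExt Γ)) ↔ ∀ Γ', Γ < Γ' → A.gain W Γ' ≤ A.gain W Γ := by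
  rw [stepRatios_toExt, mem_lowerBounds, Set.forall_mem_image]
  exact forall₂_congr fun Γ' h => A.le_ratio_iff h

theorem isGLB_stepValue {W₀ : ℝ} {Γ : Fin K → ℕ} (hΓ : A.gain W₀ Γ = A.optGain W₀) :
    IsGLB (A.stepRatios (toExt Γ)) (A.stepValue (toExt Γ)) :=
  isGLB_csInf (stepRatios_nonempty Γ)
    ⟨W₀, le_stepRatios_iff.2 fun Γ' _ => hΓ ▸ A.gain_le_optGain W₀ Γ'⟩

theorem le_stepValue {W : ℝ} {Γ : Fin K → ℕ} (hΓ : A.gain W Γ = A.optGain W) :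
    W ≤ A.stepValue (toExt Γ) :=
  (isGLB_stepValue hΓ).2 (le_stepRatios_iff.2 fun Γ' _ => hΓ ▸ A.gain_le_optGain W Γ')

/-- The infimum is itself a lower bound of the ratios, so no larger vector beats `Γ` there. Together
with `le_stepValue`, it is the largest subsidy for which `Γ` is optimal. -/
theorem gain_stepValue (hA : A.ThresholdOptimal) {W₀ : ℝ} {Γ : Fin K → ℕ}
    (hΓ : A.gain W₀ Γ = A.optGain W₀) :
    A.gain (A.stepValue (toExt Γ)) Γ = A.optGain (A.stepValue (toExt Γ)) :=
  (gain_eq_optGain_iff hA (le_stepValue hΓ) hΓ).2 (le_stepRatios_iff.1 (isGLB_stepValue hΓ).1)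

/-- The minimizers are the larger finite thresholds that are optimal for the computed value. -/
theorem mem_minimizers_iff (hA : A.ThresholdOptimal) {W₀ : ℝ} {Γ Γ' : Fin K → ℕ}
    (hΓ : A.gain W₀ Γ = A.optGain W₀) : Γ' ∈ A.minimizers (toExt Γ) ↔
      Γ < Γ' ∧ A.gain (A.stepValue (toExt Γ)) Γ' = A.optGain (A.stepValue (toExt Γ)) := by
  rw [minimizers, Set.mem_ofPred_eq, largerThresholds, Set.mem_ofPred_eq, toExt_lt_toExt]
  refine and_congr_right fun h => ?_
  rw [← gain_stepValue hA hΓ, ← A.ratio_eq_iff h]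
  simp [toExt]

theorem supClosed_minimizers (hA : A.ThresholdOptimal) {W₀ : ℝ} {Γ : Fin K → ℕ}
    (hΓ : A.gain W₀ Γ = A.optGain W₀) : SupClosed (A.minimizers (toExt Γ)) := by
  intro Γ₁ h₁ Γ₂ h₂
  rw [mem_minimizers_iff hA hΓ] at *
  exact ⟨h₁.1.trans_le le_sup_left, gain_sup_eq_optGain h₁.2 h₂.2⟩

theorem toExt_le_nextThreshold {Γ : Fin K → ℕ∞} {Γ' : Fin K → ℕ} (h : Γ' ∈ A.minimizers Γ) :
    toExt Γ' ≤ A.nextThreshold Γ :=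
  (le_iSup₂ (f := fun Γ' (_ : Γ' ∈ A.minimizers Γ) => toExt Γ') Γ' h).trans le_sup_right

theorem exists_of_le_nextThreshold {Γ : Fin K → ℕ∞} {j : Fin K} {n : ℕ} (h1 : Γ j < n)
    (h2 : n ≤ A.nextThreshold Γ j) : ∃ Γ' ∈ A.minimizers Γ, n ≤ Γ' j := by
  by_contra! hlt
  refine h2.not_gt ?_
  rw [nextThreshold, Pi.sup_apply, iSup_apply]
  refine max_lt h1 ?_
  cases n with
  | zero => simp at h1
  | succ n =>
    refine lt_of_le_of_lt (iSup_le fun Γ' => ?_) (Nat.cast_lt.2 n.lt_succ_self)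
    rw [iSup_apply]
    exact iSup_le fun hΓ' => Nat.cast_le.2 (Nat.lt_succ_iff.1 (hlt Γ' hΓ'))

/-- Each raised entry of the supremum is an entry of some minimizer, possibly a different one for
each coordinate; since optimality is tested coordinatewise, the combined vector is optimal. -/
theorem isGreatest_nextThreshold (hA : A.ThresholdOptimal) {W₀ : ℝ} {Γ Γ' : Fin K → ℕ}
    (hΓ : A.gain W₀ Γ = A.optGain W₀) (hne : (A.minimizers (toExt Γ)).Nonempty)
    (h : A.nextThreshold (toExt Γ) = toExt Γ') : IsGreatest (A.minimizers (toExt Γ)) Γ' := by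
  have hub : Γ' ∈ upperBounds (A.minimizers (toExt Γ)) := fun Γ₁ h₁ =>
    toExt_le_toExt.1 (h ▸ toExt_le_nextThreshold h₁)
  refine ⟨(mem_minimizers_iff hA hΓ).2 ⟨?_, ?_⟩, hub⟩
  · obtain ⟨Γ₁, h₁⟩ := hne
    exact ((mem_minimizers_iff hA hΓ).1 h₁).1.trans_le (hub h₁)
  · refine gain_eq_optGain_of_forall (gain_stepValue hA hΓ) fun k => ?_
    have hle : Γ k ≤ Γ' k := toExt_le_toExt.1 (h ▸ le_sup_left) k
    rcases hle.eq_or_lt with hk | hk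
    · rw [hk]
    · obtain ⟨Γ₁, h₁, hk₁⟩ := exists_of_le_nextThreshold (A := A) (Γ := toExt Γ) (j := k)
        (n := Γ' k) (Nat.cast_lt.2 hk) (by rw [h]; exact le_rfl)
      rw [← (hub h₁ k).antisymm hk₁]
      exact passiveSum_sub_le ((mem_minimizers_iff hA hΓ).1 h₁).2 k (Γ k)

theorem minimizers_eq_empty {Γ : Fin K → ℕ∞} {j : Fin K} (hj : Γ j = ⊤) :
    A.minimizers Γ = ∅ := by
  refine Set.eq_empty_of_forall_notMem fun Γ' h => ?_
  have := (show Γ < toExt Γ' from h.1).le j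
  rw [hj, top_le_iff] at this
  exact ENat.natCast_ne_top _ this

/-! ### The algorithm -/

theorem exists_gain_zero_eq_optGain : ∃ W, A.gain W 0 = A.optGain W := by
  obtain ⟨C, hC⟩ := A.exists_abs_passiveSum_le
  -- With this subsidy, passive slots earn on average at most `R1`, so sensing in every slot is
  -- optimal.
  refine ⟨A.R1 - C, (A.gain_le_optGain _ _).antisymm (A.optGain_le fun Γ => gain_le_gain fun k => ?_)⟩
  have h0 : A.gain (A.R1 - C) 0 = A.R1 := by simp [gain, cycleLength]
  rw [h0]
  simpa using le_of_abs_le (hC k (Γ k))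

/-- The finite thresholds that occur in the algorithm are optimal for some subsidy. -/
theorem exists_gain_algThreshold_eq_optGain (hA : A.ThresholdOptimal) (i : ℕ) :
    ∀ Γ : Fin K → ℕ, A.algThreshold i = toExt Γ → ∃ W, A.gain W Γ = A.optGain W := by
  induction i with
  | zero =>
    intro Γ h
    obtain rfl : Γ = 0 := funext fun j => (Nat.cast_eq_zero (R := ℕ∞)).1 (congrFun h j).symm
    exact exists_gain_zero_eq_optGain
  | succ i ih =>
    intro Γ h
    rw [algThreshold] at h
    -- Thresholds never decrease, so finite entries after a step were finite before it.
    have hfin : ∀ j, A.algThreshold i j ≠ ⊤ := fun j hj => by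
      have h1 : A.algThreshold i j ≤ A.nextThreshold (A.algThreshold i) j :=
        (le_sup_left : A.algThreshold i ≤ A.nextThreshold (A.algThreshold i)) j
      rw [hj, h, top_le_iff] at h1
      exact ENat.natCast_ne_top _ h1
    obtain ⟨Γ₀, h₀⟩ : ∃ Γ₀, A.algThreshold i = toExt Γ₀ := ⟨_, (toExt_toNat hfin).symm⟩
    obtain ⟨W₀, hW₀⟩ := ih Γ₀ h₀
    rw [h₀] at h
    rcases (A.minimizers (toExt Γ₀)).eq_empty_or_nonempty with he | hne
    · rw [nextThreshold, he] at h
      simp only [Set.mem_empty_iff_false, iSup_false, iSup_bot, sup_bot_eq] at h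
      obtain rfl : Γ₀ = Γ := funext fun j => Nat.cast_injective (R := ℕ∞) (congrFun h j)
      exact ⟨W₀, hW₀⟩
    · exact ⟨_, ((mem_minimizers_iff hA hW₀).1 (isGreatest_nextThreshold hA hW₀ hne h).1).2⟩

theorem isWhittleIndex_of_assignedAt (hA : A.ThresholdOptimal) {i : ℕ} {s : BeliefState K}
    (h : A.AssignedAt i s) : A.IsWhittleIndex s (A.algValue i) := by
  obtain ⟨Γ', hΓ', hs⟩ := exists_of_le_nextThreshold h.1 h.2
  rcases exists_toExt_or_exists_eq_top (A.algThreshold i) with ⟨Γ, hΓ⟩ | ⟨j, hj⟩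
  · obtain ⟨W₀, hW₀⟩ := exists_gain_algThreshold_eq_optGain hA i Γ hΓ
    have hna := h.1
    rw [hΓ] at hΓ' hna
    rw [algValue, hΓ]
    have hopt := A.isOptimal_toExt_iff.2 (gain_stepValue hA hW₀)
    refine ⟨⟨⟨toExt Γ', A.isOptimal_toExt_iff.2 ((mem_minimizers_iff hA hW₀).1 hΓ').2,
      -- Minimality: a policy optimal for a smaller subsidy lies below `Γ`, which is active in `s`.
      Nat.cast_le.2 hs⟩, toExt Γ, hopt, hna.not_ge⟩, fun W hW => ?_⟩
    by_contra! hlt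
    obtain ⟨Γ₁, h₁, hs₁⟩ := hW.1
    exact (le_trans hs₁ (le_of_optimal hlt h₁ hopt s.1)).not_gt hna
  · rw [minimizers_eq_empty hj] at hΓ'
    exact hΓ'.elim

/-- The assigning step is the first one whose threshold reaches the age of `s`. -/
theorem exists_assignedAt {i : ℕ} (h : ∀ j, A.algThreshold (i + 1) j = ⊤) (s : BeliefState K) :
    ∃ i' ≤ i, A.AssignedAt i' s := by
  classical
  have hex : ∃ m, ((s.2 : ℕ) : ℕ∞) ≤ A.algThreshold (m + 1) s.1 := ⟨i, by simp [h]⟩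
  refine ⟨Nat.find hex, Nat.find_min' hex (by simp [h]), ?_, Nat.find_spec hex⟩
  rcases hm : Nat.find hex with _ | m
  · simp [algThreshold]
  · exact not_le.1 (Nat.find_min hex (by omega))

/-! ### Passive rewards that do not increase with the age of the information -/

/-- The surplus is concave in the threshold, so a change of sign of its increments marks a global
maximum. -/
theorem passiveSum_sub_le_of_antitone {j : Fin K} (hR : Antitone (A.R0 j)) {u : ℝ} {n : ℕ}
    (h1 : A.R0 j n.succPNat ≤ u) (h2 : ∀ m < n, u ≤ A.R0 j m.succPNat) (n' : ℕ) :
    A.passiveSum j n' - u * n' ≤ A.passiveSum j n - u * n := by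
  rcases le_total n n' with h | h
  · induction n', h using Nat.le_induction with
    | base => exact le_rfl
    | succ m hm ih =>
      have := hR (Nat.succPNat_le_succPNat.2 hm)
      rw [passiveSum_succ]
      push_cast
      linarith
  · clear h1
    induction n, h using Nat.le_induction with
    | base => exact le_rfl
    | succ m hm ih =>
      have h3 := ih fun k hk => h2 k (hk.trans m.lt_succ_self)
      have h4 := h2 m m.lt_succ_self
      rw [passiveSum_succ]
      push_cast
      linarith

theorem nonempty_minimizers (hA : A.ThresholdOptimal) (hR : ∀ j, Antitone (A.R0 j)) {W₀ : ℝ}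
    {Γ : Fin K → ℕ} (hΓ : A.gain W₀ Γ = A.optGain W₀) : (A.minimizers (toExt Γ)).Nonempty := by
  set W := A.stepValue (toExt Γ) with hW
  have hopt : A.gain W Γ = A.optGain W := gain_stepValue hA hΓ
  by_cases h : ∃ j, A.optGain W - W ≤ A.R0 j (Γ j).succPNat
  · obtain ⟨j, hj⟩ := h
    -- One more passive slot in row `j` loses nothing against the charge U, so the raised vector is
    -- optimal as well.
    refine ⟨Function.update Γ j (Γ j + 1), (mem_minimizers_iff hA hΓ).2
      ⟨lt_update_self_iff.2 (Nat.lt_succ_self _),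
        gain_eq_optGain_of_forall hopt fun k => ?_⟩⟩
    rcases eq_or_ne k j with rfl | hk
    · rw [Function.update_self, passiveSum_succ, ← hW]
      push_cast
      linarith
    · rw [Function.update_of_ne hk]
  · push Not at h
    have hcont : Continuous fun W' => A.gain W' Γ - W' := by
      simp only [gain_sub_subsidy]
      fun_prop
    -- Otherwise every further passive slot loses strictly, and by continuity still does for some
    -- larger subsidy. Concavity then rules out that a larger vector beats `Γ` there, contrary to
    -- the maximality of `stepValue`.
    obtain ⟨W', hlt, hW'⟩ : ∃ W', W < W' ∧ ∀ j, A.R0 j (Γ j).succPNat < A.gain W' Γ - W' := by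
      have h1 : ∀ᶠ W' in nhdsWithin W (Set.Ioi W), ∀ j,
          A.R0 j (Γ j).succPNat < A.gain W' Γ - W' := Filter.eventually_all.2 fun j =>
        (hcont.tendsto W).mono_left nhdsWithin_le_nhds |>.eventually_const_lt (by
          simpa only [hopt] using h j)
      obtain ⟨W', h2, h3⟩ := (h1.and self_mem_nhdsWithin).exists
      exact ⟨W', h3, h2⟩
    refine absurd hlt (not_lt.2 ((isGLB_stepValue hΓ).2 (le_stepRatios_iff.2 fun Γ' _ =>
      gain_le_gain fun k => passiveSum_sub_le_of_antitone (hR k) (hW' k).le (fun m hm => ?_) _)))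
    have h1 : A.gain W' Γ - W' ≤ A.optGain W - W :=
      (sub_le_sub_right (A.gain_le_optGain W' Γ) _).trans (optGain_sub_antitone hlt.le)
    obtain ⟨n, hn⟩ : ∃ n, Γ k = n + 1 := ⟨Γ k - 1, by omega⟩
    have h2 := passiveSum_sub_le hopt k n
    rw [hn, passiveSum_succ] at h2
    push_cast at h2
    have h3 : A.R0 k n.succPNat ≤ A.R0 k m.succPNat :=
      hR k (Nat.succPNat_le_succPNat.2 (by omega))
    linarith

open Classical in
/-- Passive as long as the passive reward is at least `optGain W - W`. -/
noncomputable def rewardThreshold (A : Arm K) (W : ℝ) (j : Fin K) : ℕ∞ :=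
  if h : ∃ n : ℕ, A.R0 j n.succPNat < A.optGain W - W then (Nat.find h : ℕ∞) else ⊤

theorem rewardThreshold_monotone : Monotone A.rewardThreshold := fun W W' h j => by
  classical
  have hU : A.optGain W' - W' ≤ A.optGain W - W := optGain_sub_antitone h
  by_cases h' : ∃ n : ℕ, A.R0 j n.succPNat < A.optGain W' - W'
  · have h'' : ∃ n : ℕ, A.R0 j n.succPNat < A.optGain W - W :=
      h'.imp fun n hn => hn.trans_le hU
    rw [rewardThreshold, rewardThreshold, dif_pos h', dif_pos h'', Nat.cast_le]
    exact Nat.find_mono fun n hn => hn.trans_le hU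
  · rw [rewardThreshold, rewardThreshold, dif_neg h']
    exact le_top

theorem rewardThreshold_eq_top_iff {W : ℝ} {j : Fin K} :
    A.rewardThreshold W j = ⊤ ↔ ∀ n : ℕ, A.optGain W - W ≤ A.R0 j n.succPNat := by
  by_cases h : ∃ n : ℕ, A.R0 j n.succPNat < A.optGain W - W
  · rw [rewardThreshold, dif_pos h]
    exact iff_of_false (ENat.natCast_ne_top _) fun h' => h.elim fun n hn => (h' n).not_gt hn
  · rw [rewardThreshold, dif_neg h]
    exact iff_of_true rfl fun n => not_lt.1 fun hn => h ⟨n, hn⟩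

/-- Non-increasing passive rewards have an average that is not above any of them. -/
theorem Sustains.le_of_antitone {j : Fin K} (hR : Antitone (A.R0 j)) {u : ℝ}
    (h : A.Sustains j u) (n : ℕ) : u ≤ A.R0 j n.succPNat := by
  by_contra! hlt
  set r := A.R0 j n.succPNat with hr
  set ε := (u - r) / 2 with hε
  have hε0 : 0 < ε := by linarith
  have hle : ∀ m, n ≤ m → A.passiveSum j m ≤ A.passiveSum j n + r * (m - n) := fun m hm => by
    induction m, hm using Nat.le_induction with
    | base => simp
    | succ m hm ih =>
      have := hR (Nat.succPNat_le_succPNat.2 hm)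
      rw [passiveSum_succ]
      push_cast
      linarith
  obtain ⟨m, h1, h2, h3⟩ := ((h ε hε0).and ((Filter.eventually_ge_atTop n).and
    (eventually_lt_mul_natCast (A.passiveSum j n - r * n) hε0))).exists
  have h4 := hle m h2
  rw [show u - ε = r + ε by linarith] at h1
  linarith

theorem isOptimal_rewardThreshold (hA : A.ThresholdOptimal) (hR : ∀ j, Antitone (A.R0 j))
    (W : ℝ) : A.IsOptimal W (A.rewardThreshold W) := by
  classical
  by_cases htop : ∃ j, A.rewardThreshold W j = ⊤
  · rw [isOptimal_iff_of_eq_top _ htop]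
    refine fun j hj ε hε => Filter.Eventually.of_forall fun n => ?_
    have h1 : (Finset.range n).card • (A.optGain W - W) ≤ A.passiveSum j n :=
      Finset.card_nsmul_le_sum _ _ _ fun r _ => rewardThreshold_eq_top_iff.1 hj r
    rw [Finset.card_range, nsmul_eq_mul] at h1
    have := mul_nonneg hε.le (Nat.cast_nonneg (α := ℝ) n)
    linarith
  · obtain ⟨Γ', hΓ'⟩ := hA W
    rcases exists_toExt_or_exists_eq_top Γ' with ⟨Γ', rfl⟩ | ⟨j, hj⟩
    · push Not at htop
      have hex : ∀ j, ∃ n : ℕ, A.R0 j n.succPNat < A.optGain W - W := fun j => by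
        simpa only [not_forall, not_le] using mt rewardThreshold_eq_top_iff.2 (htop j)
      have heq : A.rewardThreshold W = toExt fun j => Nat.find (hex j) :=
        funext fun j => dif_pos (hex j)
      rw [heq, isOptimal_toExt_iff]
      refine gain_eq_optGain_of_forall (A.isOptimal_toExt_iff.1 hΓ') fun k =>
        passiveSum_sub_le_of_antitone (hR k) (Nat.find_spec (hex k)).le (fun m hm => ?_) _
      exact not_lt.1 (Nat.find_min (hex k) hm)
    -- An optimal vector with infinite entry `j` sustains U, so all passive rewards in row `j` are
    -- at least U and `rewardThreshold W j` would be infinite.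
    · exact absurd ⟨j, rewardThreshold_eq_top_iff.2
        (((A.isOptimal_iff_of_eq_top ⟨j, hj⟩).1 hΓ' j hj).le_of_antitone (hR j))⟩ htop

end Arm

theorem theorem3 {N K : ℕ} (arm : Fin N → Arm K)
    (h_threshold : ∀ n, (arm n).ThresholdOptimal)
    (h_mono : ∀ n, Monotone (arm n).passiveProb) :
    ProblemIndexable arm ∧
    ∀ n,
      -- the value computed in a step is the Whittle index of the states assigned in that step
      (∀ i s, (arm n).AssignedAt i s → (arm n).IsWhittleIndex s ((arm n).algValue i)) ∧
      -- if all thresholds are infinite after some step, then all states have been assigned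
      (∀ i, (∀ j, (arm n).algThreshold (i + 1) j = ⊤) →
        ∀ s, ∃ i' ≤ i, (arm n).AssignedAt i' s ∧
          (arm n).IsWhittleIndex s ((arm n).algValue i')) ∧
      -- each step that starts from finite thresholds is well defined: the infimum is a true one,
      -- and the supremum of the minimizers is the largest minimizer
      (∀ i, (∀ j, (arm n).algThreshold i j ≠ ⊤) →
        ((arm n).stepRatios ((arm n).algThreshold i)).Nonempty ∧
        IsGLB ((arm n).stepRatios ((arm n).algThreshold i)) ((arm n).algValue i) ∧
        SupClosed ((arm n).minimizers ((arm n).algThreshold i)) ∧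
        ∀ Γ : Fin K → ℕ, ((arm n).minimizers ((arm n).algThreshold i)).Nonempty →
          (arm n).algThreshold (i + 1) = toExt Γ →
          IsGreatest ((arm n).minimizers ((arm n).algThreshold i)) Γ) ∧
      -- if the passive reward does not increase with the age of the information, then the optimal
      -- thresholds can be chosen monotone in the subsidy, and the infimum is always attained
      ((∀ j, Antitone ((arm n).R0 j)) →
        (∃ Γ : ℝ → Fin K → ℕ∞, Monotone Γ ∧ ∀ W, (arm n).IsOptimal W (Γ W)) ∧
        ∀ i, (∀ j, (arm n).algThreshold i j ≠ ⊤) →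
          ((arm n).minimizers ((arm n).algThreshold i)).Nonempty) := by
  refine ⟨fun n => (arm n).indexable (h_threshold n), fun n => ?_⟩
  have hA := h_threshold n
  have hfin : ∀ i, (∀ j, (arm n).algThreshold i j ≠ ⊤) → ∃ (Γ : Fin K → ℕ) (W : ℝ),
      (arm n).algThreshold i = toExt Γ ∧ (arm n).gain W Γ = (arm n).optGain W := fun i hi => by
    obtain ⟨W, hW⟩ := Arm.exists_gain_algThreshold_eq_optGain hA i _ (toExt_toNat hi).symm
    exact ⟨_, W, (toExt_toNat hi).symm, hW⟩
  refine ⟨fun i s h => Arm.isWhittleIndex_of_assignedAt hA h, fun i h s => ?_, fun i hi => ?_,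
    fun hR => ⟨⟨_, Arm.rewardThreshold_monotone, Arm.isOptimal_rewardThreshold hA hR⟩,
      fun i hi => ?_⟩⟩
  · obtain ⟨i', hi', h'⟩ := Arm.exists_assignedAt h s
    exact ⟨i', hi', h', Arm.isWhittleIndex_of_assignedAt hA h'⟩
  · obtain ⟨Γ₀, W₀, h₀, hW₀⟩ := hfin i hi
    rw [Arm.algValue, Arm.algThreshold, h₀]
    exact ⟨Arm.stepRatios_nonempty Γ₀, Arm.isGLB_stepValue hW₀, Arm.supClosed_minimizers hA hW₀,
      fun Γ hne h => Arm.isGreatest_nextThreshold hA hW₀ hne h⟩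
  · obtain ⟨Γ₀, W₀, h₀, hW₀⟩ := hfin i hi
    rw [h₀]
    exact Arm.nonempty_minimizers hA hR hW₀
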